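/- Let $G=(V,E)$ be a finite connected simple (undirected) graph with $n=|V|\ge 2$ vertices. Lazy simple random walk (LSRW) on $G$ has transition matrix $P$ with $P(u,u)=1/2$ and $P(u,v)=1/(2d_u)$ for each neighbour $v$ of $u$, where $d_u$ is the degree of $u$. The spectral gap $\gamma(G)$ is the smallest non-zero eigenvalue of $I-P$, and $G$ is called a $\lambda$-expander if $\gamma(G)\ge\lambda$. In the social network model on $G$, the numbers $N_v$ of walkers that start at the vertices $v\in V$ are independent, $N_v$ being Poisson with mean $|V|\,d_v/(2|E|)$ (which is $1$ if $G$ is regular), and, given these numbers, all walkers perform independent LSRWs on $G$ in discrete time, moving simultaneously. Two walkers have met by time $t$ if they were at the same vertex at the same time $s$ for some $s\le t$. Two walkers $a,b$ have a path of acquaintances by time $t$ if there are $k\ge 0$ and walkers $a=c_0,c_1,\dots,c_{k+1}=b$ such that $c_i$ and $c_{i+1}$ have met by time $t$ for all $0\le i\le k$. The social connectivity time $\mathrm{SC}(G)$ is the first time by which every pair of walkers has a path of acquaintances ($\infty$ if there is no such time). Theorem. There exist absolute constants $C,C',C_0>0$ such that for every connected $d$-regular $n$-vertex graph $G$ with $n\ge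 2$ and every $\lambda>0$ such that $G$ is a $\lambda$-expander and $\lambda\log n\ge C_0\log d$ (that is, $\lambda\log_d n\ge C_0$ when $d\ge 2$), $$\Pr\left[\mathrm{SC}(G)\le C\lambda^{-1}\log n\right]\ \ge\ 1-\frac{C'}{n}.$$ -/

import Mathlib

open MeasureTheory ProbabilityTheory
open scoped NNReal ENNReal

namespace SocialNetwork

noncomputable section

/-- The transition matrix of the lazy simple random walk (LSRW) on `G`: the walk stays put with
probability `1/2` and moves to each neighbour with probability `1/(2 * degree)`.
(At an isolated vertex, which a connected graph with at least two vertices does not have,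
the walk stays put.) -/
def lsrwMatrix {V : Type*} [Fintype V] [DecidableEq V] (G : SimpleGraph V) [DecidableRel G.Adj] :
    Matrix V V ℝ :=
  fun u v =>
    if u = v then (if G.degree u = 0 then 1 else 1 / 2)
    else if G.Adj u v then 1 / (2 * (G.degree u : ℝ)) else 0

/-- The spectral gap of LSRW on `G`: the smallest non-zero eigenvalue of `I - P`. -/
def spectralGap {V : Type*} [Fintype V] [DecidableEq V] (G : SimpleGraph V) [DecidableRel G.Adj] :
    ℝ :=
  sInf {μ : ℝ | μ ≠ 0 ∧ Module.End.HasEigenvalue (Matrix.toLin' (1 - lsrwMatrix G)) μ}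

/-- `G` is a `lam`-expander: the spectral gap of LSRW on `G` is at least `lam`. -/
def IsExpander {V : Type*} [Fintype V] [DecidableEq V] (G : SimpleGraph V) [DecidableRel G.Adj]
    (lam : ℝ) : Prop :=
  lam ≤ spectralGap G

theorem lsrwMatrix_nonneg {V : Type*} [Fintype V] [DecidableEq V] (G : SimpleGraph V)
    [DecidableRel G.Adj] (u v : V) : 0 ≤ lsrwMatrix G u v := by
  unfold lsrwMatrix
  split_ifs <;> positivity

theorem lsrwMatrix_row_sum {V : Type*} [Fintype V] [DecidableEq V] (G : SimpleGraph V)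
    [DecidableRel G.Adj] (u : V) : ∑ v, lsrwMatrix G u v = 1 := by
  have h : ∀ v, lsrwMatrix G u v = (if u = v then (if G.degree u = 0 then 1 else 1 / 2) else 0)
      + (if G.Adj u v then 1 / (2 * (G.degree u : ℝ)) else 0) := by
    intro v
    unfold lsrwMatrix
    by_cases huv : u = v
    · subst huv; simp
    · simp [huv]
  simp_rw [h]
  rw [Finset.sum_add_distrib, Finset.sum_ite_eq, ← Finset.sum_filter]
  rw [Finset.sum_const, ← SimpleGraph.neighborFinset_eq_filter, SimpleGraph.card_neighborFinset_eq_degree]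
  by_cases hd : G.degree u = 0
  · simp [hd]
  · have : (G.degree u : ℝ) ≠ 0 := by exact_mod_cast hd
    simp only [Finset.mem_univ, if_true, hd, if_false, nsmul_eq_mul]
    field_simp
    norm_num

/-- One step of LSRW on `G`, as a Markov kernel: from `u`, the next position is `v` with
probability `P u v`. -/
def lsrwKernel {V : Type*} [Fintype V] [DecidableEq V] [MeasurableSpace V]
    [DiscreteMeasurableSpace V] (G : SimpleGraph V) [DecidableRel G.Adj] : Kernel V V where
  toFun u := ∑ v, ENNReal.ofReal (lsrwMatrix G u v) • Measure.dirac v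
  measurable' := Measurable.of_discrete

instance {V : Type*} [Fintype V] [DecidableEq V] [MeasurableSpace V]
    [DiscreteMeasurableSpace V] (G : SimpleGraph V) [DecidableRel G.Adj] :
    IsMarkovKernel (lsrwKernel G) where
  isProbabilityMeasure u := ⟨by
    change (∑ v, ENNReal.ofReal (lsrwMatrix G u v) • Measure.dirac v : Measure V) Set.univ = 1
    simp only [Measure.coe_finsetSum, Finset.sum_apply, Measure.smul_apply, measure_univ,
      smul_eq_mul, mul_one]
    rw [← ENNReal.ofReal_sum_of_nonneg (fun v _ => lsrwMatrix_nonneg G u v),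
      lsrwMatrix_row_sum, ENNReal.ofReal_one]⟩

/-- The step from time `n` to time `n + 1`, as a kernel depending on the past trajectory only
through its last position. -/
def lsrwStep {V : Type*} [Fintype V] [DecidableEq V] [MeasurableSpace V]
    [DiscreteMeasurableSpace V] (G : SimpleGraph V) [DecidableRel G.Adj] (n : ℕ) :
    Kernel (Finset.Iic n → V) V :=
  (lsrwKernel G).comap (fun h => h ⟨n, Finset.mem_Iic.2 le_rfl⟩) (measurable_pi_apply _)

instance {V : Type*} [Fintype V] [DecidableEq V] [MeasurableSpace V]
    [DiscreteMeasurableSpace V] (G : SimpleGraph V) [DecidableRel G.Adj] (n : ℕ) :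
    IsMarkovKernel (lsrwStep G n) := by
  unfold lsrwStep; infer_instance

/-- The law, on the space of trajectories `ℕ → V`, of LSRW on `G` started at `v`. -/
def lsrwLaw {V : Type*} [Fintype V] [DecidableEq V] [MeasurableSpace V]
    [DiscreteMeasurableSpace V] (G : SimpleGraph V) [DecidableRel G.Adj] (v : V) :
    Measure (ℕ → V) :=
  Kernel.traj (X := fun _ => V) (lsrwStep G) 0 (fun _ => v)

instance {V : Type*} [Fintype V] [DecidableEq V] [MeasurableSpace V]
    [DiscreteMeasurableSpace V] (G : SimpleGraph V) [DecidableRel G.Adj] (v : V) :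
    IsProbabilityMeasure (lsrwLaw G v) := by
  unfold lsrwLaw; infer_instance

/-- Configurations of the social network model: `ω.1 v` is the number of walkers that start at the
vertex `v`, and `ω.2 (v, i)` is the trajectory of the `i`-th walker that starts at `v`;
it is used only when `i < ω.1 v`. -/
abbrev Config (V : Type*) : Type _ := (V → ℕ) × (V × ℕ → ℕ → V)

/-- The stationary distribution of LSRW, times the number of vertices: `|V| * d_v / (2 * |E|)`. -/
def initialDensity {V : Type*} [Fintype V] [DecidableEq V] (G : SimpleGraph V)
    [DecidableRel G.Adj] (v : V) : ℝ≥0 :=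
  (Fintype.card V : ℝ≥0) * ((G.degree v : ℝ≥0) / (2 * (G.edgeFinset.card : ℝ≥0)))

/-- The law of the social network model on `G`: the numbers of walkers that start at the vertices
are independent Poisson variables of means `initialDensity G v`, and, independently of them, all
walkers perform independent LSRWs. -/
def snLaw {V : Type*} [Fintype V] [DecidableEq V] [MeasurableSpace V]
    [DiscreteMeasurableSpace V] (G : SimpleGraph V) [DecidableRel G.Adj] : Measure (Config V) :=
  (Measure.pi fun v : V => poissonMeasure (initialDensity G v)).prod
    (Measure.infinitePi fun w : V × ℕ => lsrwLaw G w.1)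

/-- The walkers present in a configuration. -/
abbrev Walker {V : Type*} (ω : Config V) : Type _ := {w : V × ℕ // w.2 < ω.1 w.1}

/-- Two walkers have met by time `t`: at some time `s ≤ t` they had the same position. -/
def MetBy {V : Type*} (ω : Config V) (t : ℕ) (a b : Walker ω) : Prop :=
  ∃ s ≤ t, ω.2 a.1 s = ω.2 b.1 s

/-- Two walkers have a path of acquaintances by time `t`. -/
def AcquaintedBy {V : Type*} (ω : Config V) (t : ℕ) : Walker ω → Walker ω → Prop :=
  Relation.TransGen (MetBy ω t)

/-- The social connectivity time: the first time by which every pair of walkers has a path of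
acquaintances (`⊤` if there is no such time). -/
def socialConnectivityTime {V : Type*} (ω : Config V) : ℕ∞ :=
  ⨅ (t : ℕ) (_ : ∀ a b : Walker ω, AcquaintedBy ω t a b), (t : ℕ∞)

end

end SocialNetwork

/-! Let `J` be about `1 / lam` and `L` about `512 log n`. Then `J` steps of the walk at least halve
functions of mean zero in ℓ², and `J * L` steps make all transition probabilities uniform within a
factor 2 (`IsExpander.mixes`). Meetings are sought only at multiples of `J`, and a time of order `J
* L` turns out to suffice.

Walkers with a common starting vertex meet at time 0, so an acquaintance class is described by its
starting vertices, each represented by its first walker. If some pair is not acquainted, split the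
walkers into one class and its complement. Either one side has at most `n / 30000` starting
vertices, and its representatives meet nobody from outside, or both sides contain `n / 30000`
vertices and the representatives of the two sets never meet (`exists_isolated_or_no_meeting`). Both
cases are excluded by union bounds.

Small set `U` of size `m`: condition on its representatives. By Poisson thinning the number of
outside walkers that hit them is Poisson, so the probability of no hit is `exp(-mean)`
(`snLaw_real_forall_mem_eq_sum`). If the representatives occupy at least `m / 2` sites at `L`
suitable times, a second moment computation bounds the mean below by `min (n / 32) (L m / 128)`
(`Mixes.min_le_sum_one_sub`): by the expander mixing lemma, visits at times `J s` and `J t` have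
total correlation at most `m² / n + 2^(-|s - t|) m`. As `L` is a large multiple of `log n`, this
beats the `n.choose m` choices of `U`. Squeezing `m` independent walkers into `m / 2` sites at ten
times `J * L` apart has probability at most `(6 m / n)^(5 m)`, which also beats them
(`Mixes.walkersLaw_real_card_le`).

Two large sets: over a constant number of periods of length `J * L` they fail to meet with
probability of order `exp(-4n)` (`Mixes.walkersLaw_real_no_meeting_le`), against at most `exp(2n)`
pairs. -/

namespace SocialNetwork

open Finset Matrix

/-! ### Spectral gap, ℓ² contraction and the expander mixing lemma. -/

section Spectral

variable {V : Type*} [Fintype V] [DecidableEq V]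

/-- Parseval in an eigenbasis: eigenvectors orthogonal to `f` do not contribute, so their
eigenvalues are unconstrained. -/
theorem sum_sq_mulVec_le {P : Matrix V V ℝ} (hP : P.IsHermitian) {θ : ℝ} (f : V → ℝ)
    (h : ∀ i, ∑ x, hP.eigenvectorBasis i x * f x = 0 ∨ |hP.eigenvalues i| ≤ θ) :
    ∑ x, (P *ᵥ f) x ^ 2 ≤ θ ^ 2 * ∑ x, f x ^ 2 := by
  have inner_eq : ∀ i (g : V → ℝ), inner ℝ (hP.eigenvectorBasis i) (WithLp.toLp 2 g)
      = ∑ x, hP.eigenvectorBasis i x * g x := by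
    intro i g
    simp [PiLp.inner_apply, mul_comm]
  have parseval : ∀ g : V → ℝ, ∑ x, g x ^ 2
      = ∑ i, (∑ x, hP.eigenvectorBasis i x * g x) ^ 2 := by
    intro g
    have := hP.eigenvectorBasis.sum_sq_norm_inner_right (WithLp.toLp 2 g)
    rw [EuclideanSpace.norm_sq_eq] at this
    simp only [inner_eq, Real.norm_eq_abs, sq_abs] at this
    exact this.symm
  rw [parseval (P *ᵥ f), parseval f, mul_sum]
  refine sum_le_sum fun i _ => ?_
  have key : ∑ x, hP.eigenvectorBasis i x * (P *ᵥ f) x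
      = hP.eigenvalues i * ∑ x, hP.eigenvectorBasis i x * f x := by
    have h1 : (⇑(hP.eigenvectorBasis i) : V → ℝ) ⬝ᵥ P *ᵥ f
        = (P *ᵥ ⇑(hP.eigenvectorBasis i)) ⬝ᵥ f := by
      rw [dotProduct_mulVec, ← mulVec_transpose]
      congr 2
    rw [hP.mulVec_eigenvectorBasis, smul_dotProduct] at h1
    simpa [dotProduct] using h1
  rw [key, mul_pow]
  rcases h i with h0 | h0
  · simp [h0]
  · refine mul_le_mul_of_nonneg_right ?_ (sq_nonneg _)
    rw [← sq_abs]
    exact pow_le_pow_left₀ (abs_nonneg _) h0 2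

variable (G : SimpleGraph V) [DecidableRel G.Adj] {d : ℕ}

theorem lsrwMatrix_isSymm (hd : G.IsRegularOfDegree d) (x y : V) :
    lsrwMatrix G x y = lsrwMatrix G y x := by
  unfold lsrwMatrix
  simp only [hd.degree_eq, eq_comm (a := x), G.adj_comm x]

theorem lsrwMatrix_col_sum (hd : G.IsRegularOfDegree d) (y : V) : ∑ x, lsrwMatrix G x y = 1 := by
  simp_rw [lsrwMatrix_isSymm G hd _ y]
  exact lsrwMatrix_row_sum G y

theorem lsrwMatrix_mulVec_const (c : ℝ) : lsrwMatrix G *ᵥ (fun _ => c) = fun _ => c := by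
  ext x
  simp [mulVec, dotProduct, ← sum_mul, lsrwMatrix_row_sum]

theorem sum_lsrwMatrix_mul_sq_sub (hd : G.IsRegularOfDegree d) (f : V → ℝ) :
    ∑ x, ∑ y, lsrwMatrix G x y * (f x - f y) ^ 2
      = 2 * (∑ x, f x ^ 2 - ∑ x, f x * (lsrwMatrix G *ᵥ f) x) := by
  have h1 : ∑ x, ∑ y, lsrwMatrix G x y * f x ^ 2 = ∑ x, f x ^ 2 := by
    simp_rw [← sum_mul, lsrwMatrix_row_sum, one_mul]
  have h2 : ∑ x, ∑ y, lsrwMatrix G x y * f y ^ 2 = ∑ x, f x ^ 2 := by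
    rw [sum_comm]
    simp_rw [← sum_mul, lsrwMatrix_col_sum G hd, one_mul]
  have h3 : ∑ x, f x * (lsrwMatrix G *ᵥ f) x = ∑ x, ∑ y, lsrwMatrix G x y * (f x * f y) := by
    simp only [mulVec, dotProduct, mul_sum]
    exact sum_congr rfl fun x _ => sum_congr rfl fun y _ => by ring
  rw [h3, mul_sub, two_mul]
  nth_rw 1 [← h1]
  rw [← h2, mul_sum, ← sum_add_distrib, ← sum_sub_distrib]
  refine sum_congr rfl fun x _ => ?_
  rw [mul_sum, ← sum_add_distrib, ← sum_sub_distrib]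
  exact sum_congr rfl fun y _ => by ring

theorem lsrwMatrix_self (hd : G.IsRegularOfDegree d) (hd0 : d ≠ 0) (x : V) :
    lsrwMatrix G x x = 1 / 2 := by
  simp [lsrwMatrix, hd.degree_eq, hd0]

/-- This is where laziness enters. In the sum of `P x y * (f x + f y) ^ 2` the diagonal terms alone,
of weight 1/2, give `2 * ∑ f x ^ 2`. -/
theorem sum_mul_lsrwMatrix_mulVec_nonneg (hd : G.IsRegularOfDegree d) (hd0 : d ≠ 0) (f : V → ℝ) :
    0 ≤ ∑ x, f x * (lsrwMatrix G *ᵥ f) x := by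
  have h : ∑ x, ∑ y, lsrwMatrix G x y * (f x - f y) ^ 2
      = ∑ x, ∑ y, (2 * (lsrwMatrix G x y * (f x ^ 2 + f y ^ 2))
        - lsrwMatrix G x y * (f x + f y) ^ 2) :=
    sum_congr rfl fun x _ => sum_congr rfl fun y _ => by ring
  have h1 : ∑ x, ∑ y, lsrwMatrix G x y * f x ^ 2 = ∑ x, f x ^ 2 := by
    simp_rw [← sum_mul, lsrwMatrix_row_sum, one_mul]
  have h2 : ∑ x, ∑ y, lsrwMatrix G x y * f y ^ 2 = ∑ x, f x ^ 2 := by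
    rw [sum_comm]
    simp_rw [← sum_mul, lsrwMatrix_col_sum G hd, one_mul]
  simp only [sum_sub_distrib, ← mul_sum, mul_add, sum_add_distrib, h1, h2] at h
  rw [sum_lsrwMatrix_mul_sq_sub G hd] at h
  have h3 : ∑ x, 2 * f x ^ 2 ≤ ∑ x, ∑ y, lsrwMatrix G x y * (f x + f y) ^ 2 := by
    refine sum_le_sum fun x _ => ?_
    refine le_trans (le_of_eq ?_) (single_le_sum (f := fun y => lsrwMatrix G x y * (f x + f y) ^ 2)
      (fun y _ => mul_nonneg (lsrwMatrix_nonneg G x y) (sq_nonneg _)) (mem_univ x))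
    simp only [lsrwMatrix_self G hd hd0]
    ring
  rw [← mul_sum] at h3
  linarith

theorem sum_sq_pos_of_ne_zero {V : Type*} [Fintype V] {f : V → ℝ} (hf : f ≠ 0) : 0 < ∑ x, f x ^ 2 := by
  obtain ⟨x, hx⟩ := Function.ne_iff.1 hf
  exact sum_pos' (fun _ _ => sq_nonneg _) ⟨x, mem_univ x, by simpa using sq_pos_of_ne_zero hx⟩

theorem sum_sq_mul_eq_of_mulVec_eq {f : V → ℝ} {μ : ℝ} (h : lsrwMatrix G *ᵥ f = μ • f) :
    ∑ x, f x * (lsrwMatrix G *ᵥ f) x = μ * ∑ x, f x ^ 2 := by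
  rw [h, mul_sum]
  exact sum_congr rfl fun x _ => by simp only [Pi.smul_apply, smul_eq_mul]; ring

theorem nonneg_and_le_one_of_mulVec_eq (hd : G.IsRegularOfDegree d) (hd0 : d ≠ 0)
    {f : V → ℝ} (hf : f ≠ 0) {μ : ℝ} (h : lsrwMatrix G *ᵥ f = μ • f) : 0 ≤ μ ∧ μ ≤ 1 := by
  have hpos := sum_sq_pos_of_ne_zero hf
  have h1 := sum_sq_mul_eq_of_mulVec_eq G h
  have h2 := sum_mul_lsrwMatrix_mulVec_nonneg G hd hd0 f
  have h3 := sum_lsrwMatrix_mul_sq_sub G hd f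
  have h4 : 0 ≤ ∑ x, ∑ y, lsrwMatrix G x y * (f x - f y) ^ 2 :=
    sum_nonneg fun x _ => sum_nonneg fun y _ =>
      mul_nonneg (lsrwMatrix_nonneg G x y) (sq_nonneg _)
  constructor
  · rw [h1] at h2
    exact nonneg_of_mul_nonneg_left h2 hpos
  · rw [h3, h1] at h4
    nlinarith

theorem eq_of_mulVec_eq_self (hd : G.IsRegularOfDegree d) (hd0 : d ≠ 0) (hG : G.Connected)
    {f : V → ℝ} (h : lsrwMatrix G *ᵥ f = f) (x y : V) : f x = f y := by
  have h3 := sum_lsrwMatrix_mul_sq_sub G hd f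
  rw [sum_sq_mul_eq_of_mulVec_eq G (μ := 1) (by simpa using h), one_mul, sub_self, mul_zero] at h3
  have adj : ∀ x y, G.Adj x y → f x = f y := by
    intro x y hxy
    have h5 := (sum_eq_zero_iff_of_nonneg (fun x _ => sum_nonneg fun y _ =>
      mul_nonneg (lsrwMatrix_nonneg G x y) (sq_nonneg _))).1 h3 x (mem_univ x)
    have h6 := (sum_eq_zero_iff_of_nonneg (fun y _ =>
      mul_nonneg (lsrwMatrix_nonneg G x y) (sq_nonneg _))).1 h5 y (mem_univ y)
    have h7 : lsrwMatrix G x y ≠ 0 := by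
      simp [lsrwMatrix, hxy.ne, hxy, hd.degree_eq, hd0]
    have h8 := (mul_eq_zero.1 h6).resolve_left h7
    exact sub_eq_zero.1 (pow_eq_zero_iff (two_ne_zero) |>.1 h8)
  obtain ⟨p⟩ := hG.preconnected x y
  induction p with
  | nil => rfl
  | cons hxy _ ih => exact (adj _ _ hxy).trans ih

theorem hasEigenvalue_one_sub_iff (ν : ℝ) :
    Module.End.HasEigenvalue (Matrix.toLin' (1 - lsrwMatrix G)) ν ↔
      ∃ f : V → ℝ, f ≠ 0 ∧ lsrwMatrix G *ᵥ f = (1 - ν) • f := by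
  constructor
  · intro h
    obtain ⟨f, hf⟩ := h.exists_hasEigenvector
    refine ⟨f, hf.2, ?_⟩
    have := hf.apply_eq_smul
    rw [Matrix.toLin'_apply, sub_mulVec, one_mulVec] at this
    rw [sub_smul, one_smul, ← this]
    abel
  · rintro ⟨f, hf, h⟩
    refine Module.End.hasEigenvalue_of_hasEigenvector (x := f) ?_
    rw [Module.End.hasEigenvector_iff, Module.End.mem_eigenspace_iff]
    refine ⟨?_, hf⟩
    rw [Matrix.toLin'_apply, sub_mulVec, one_mulVec, h, sub_smul, one_smul]
    abel

variable {lam : ℝ}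

theorem IsExpander.le_one (hd : G.IsRegularOfDegree d) (hd0 : d ≠ 0)
    (h : IsExpander G lam) : lam ≤ 1 := by
  by_contra! h1
  -- The infimum of the empty set in `ℝ` is 0, so without a non-zero eigenvalue `lam` would be
  -- nonpositive.
  have hne : {μ : ℝ | μ ≠ 0 ∧
      Module.End.HasEigenvalue (Matrix.toLin' (1 - lsrwMatrix G)) μ}.Nonempty := by
    by_contra! he
    have : lam ≤ 0 := by
      unfold IsExpander spectralGap at h
      rwa [he, Real.sInf_empty] at h
    linarith
  obtain ⟨ν, hν, hev⟩ := hne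
  have hle : spectralGap G ≤ ν := by
    refine csInf_le ⟨0, ?_⟩ ⟨hν, hev⟩
    rintro ρ ⟨-, hρ⟩
    obtain ⟨f, hf, hff⟩ := (hasEigenvalue_one_sub_iff G ρ).1 hρ
    linarith [(nonneg_and_le_one_of_mulVec_eq G hd hd0 hf hff).2]
  obtain ⟨f, hf, hff⟩ := (hasEigenvalue_one_sub_iff G ν).1 hev
  have := (nonneg_and_le_one_of_mulVec_eq G hd hd0 hf hff).1
  have : lam ≤ spectralGap G := h
  linarith

/-- By connectedness, eigenvectors of eigenvalue 1 are constant, hence orthogonal to `f`. All other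
eigenvalues lie in `[0, 1 - lam]`. -/
theorem sum_sq_lsrwMatrix_mulVec_le (hd : G.IsRegularOfDegree d) (hd0 : d ≠ 0) (hG : G.Connected)
    (h : IsExpander G lam) (f : V → ℝ) (hf : ∑ x, f x = 0) :
    ∑ x, (lsrwMatrix G *ᵥ f) x ^ 2 ≤ (1 - lam) ^ 2 * ∑ x, f x ^ 2 := by
  have hP : (lsrwMatrix G).IsHermitian := by
    ext x y
    simp [conjTranspose_apply, lsrwMatrix_isSymm G hd y x]
  refine sum_sq_mulVec_le hP f fun i => ?_
  have hv := hP.mulVec_eigenvectorBasis i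
  set e : V → ℝ := ⇑(hP.eigenvectorBasis i) with he
  have he0 : e ≠ 0 := by
    intro h0
    apply hP.eigenvectorBasis.orthonormal.ne_zero i
    ext x
    exact congrFun h0 x
  by_cases h1 : hP.eigenvalues i = 1
  · left
    rw [h1, one_smul] at hv
    have : ∀ x y, e x = e y := eq_of_mulVec_eq_self G hd hd0 hG hv
    obtain ⟨x₀, -⟩ := Function.ne_iff.1 he0
    simp_rw [this _ x₀, ← mul_sum, hf, mul_zero]
  · right
    have h01 := nonneg_and_le_one_of_mulVec_eq G hd hd0 he0 hv
    have : spectralGap G ≤ 1 - hP.eigenvalues i := by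
      refine csInf_le ⟨0, ?_⟩ ⟨by simpa [sub_eq_zero] using Ne.symm h1, ?_⟩
      · rintro ρ ⟨-, hρ⟩
        obtain ⟨f, hf, hff⟩ := (hasEigenvalue_one_sub_iff G ρ).1 hρ
        linarith [(nonneg_and_le_one_of_mulVec_eq G hd hd0 hf hff).2]
      · exact (hasEigenvalue_one_sub_iff G _).2 ⟨e, he0, by simpa using hv⟩
    have h2 : lam ≤ spectralGap G := h
    rw [abs_of_nonneg h01.1]
    linarith

theorem lsrwMatrix_pow_nonneg (k : ℕ) (x y : V) : 0 ≤ (lsrwMatrix G ^ k) x y := by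
  induction k generalizing x y with
  | zero => rw [pow_zero, one_apply]; split_ifs <;> norm_num
  | succ k ih =>
    rw [pow_succ, mul_apply]
    exact sum_nonneg fun z _ => mul_nonneg (ih x z) (lsrwMatrix_nonneg G z y)

theorem lsrwMatrix_pow_mulVec_const (k : ℕ) (c : ℝ) :
    (lsrwMatrix G ^ k) *ᵥ (fun _ => c) = fun _ => c := by
  induction k with
  | zero => simp
  | succ k ih => rw [pow_succ, ← mulVec_mulVec, lsrwMatrix_mulVec_const, ih]

theorem lsrwMatrix_pow_row_sum (k : ℕ) (x : V) : ∑ y, (lsrwMatrix G ^ k) x y = 1 := by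
  simpa [mulVec, dotProduct] using congrFun (lsrwMatrix_pow_mulVec_const G k 1) x

theorem lsrwMatrix_pow_isSymm (hd : G.IsRegularOfDegree d) (k : ℕ) (x y : V) :
    (lsrwMatrix G ^ k) x y = (lsrwMatrix G ^ k) y x := by
  have h : (lsrwMatrix G)ᵀ = lsrwMatrix G := by
    ext x y
    exact lsrwMatrix_isSymm G hd y x
  conv_lhs => rw [← h, ← transpose_pow]
  rfl

theorem lsrwMatrix_pow_col_sum (hd : G.IsRegularOfDegree d) (k : ℕ) (y : V) :
    ∑ x, (lsrwMatrix G ^ k) x y = 1 := by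
  simp_rw [lsrwMatrix_pow_isSymm G hd k _ y]
  exact lsrwMatrix_pow_row_sum G k y

theorem sum_sq_lsrwMatrix_pow_mulVec_le (hd : G.IsRegularOfDegree d) (hd0 : d ≠ 0)
    (hG : G.Connected) (h : IsExpander G lam) (k : ℕ) (f : V → ℝ) (hf : ∑ x, f x = 0) :
    ∑ x, ((lsrwMatrix G ^ k) *ᵥ f) x = 0 ∧
    ∑ x, ((lsrwMatrix G ^ k) *ᵥ f) x ^ 2 ≤ ((1 - lam) ^ k) ^ 2 * ∑ x, f x ^ 2 := by
  induction k with
  | zero => simp [hf]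
  | succ k ih =>
    rw [pow_succ', ← mulVec_mulVec]
    constructor
    · simp only [mulVec, dotProduct]
      rw [sum_comm]
      simp_rw [← sum_mul, lsrwMatrix_col_sum G hd, one_mul]
      exact ih.1
    · refine (sum_sq_lsrwMatrix_mulVec_le G hd hd0 hG h _ ih.1).trans ?_
      calc _ ≤ (1 - lam) ^ 2 * (((1 - lam) ^ k) ^ 2 * ∑ x, f x ^ 2) := by gcongr; exact ih.2
        _ = _ := by ring

/-- The expander mixing lemma for the `k`-step transition matrix of LSRW. -/
theorem abs_sum_lsrwMatrix_pow_sub_le (hd : G.IsRegularOfDegree d) (hd0 : d ≠ 0)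
    (hG : G.Connected) (h : IsExpander G lam) (k : ℕ) (A B : Finset V) :
    |∑ x ∈ A, ∑ y ∈ B, (lsrwMatrix G ^ k) x y - (#A * #B : ℝ) / Fintype.card V|
      ≤ (1 - lam) ^ k * √(#A * #B) := by
  have hne : Nonempty V := hG.nonempty
  have hn : (Fintype.card V : ℝ) ≠ 0 := by exact_mod_cast Fintype.card_ne_zero
  set n : ℝ := (Fintype.card V : ℝ) with hndef
  set f : V → ℝ := fun y => (if y ∈ B then 1 else 0) - #B / n with hfdef
  have hf : ∑ y, f y = 0 := by
    simp only [hfdef, sum_sub_distrib, sum_ite_mem, univ_inter, sum_const, card_univ, nsmul_eq_mul,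
      mul_one, ← hndef]
    field_simp
    simp
  have hf2 : ∑ y, f y ^ 2 ≤ #B := by
    have : ∑ y, f y ^ 2 = #B - (#B : ℝ) ^ 2 / n := by
      have h1 : ∀ y, f y ^ 2 = (if y ∈ B then 1 - 2 * (#B / n) else 0) + (#B / n) ^ 2 := by
        intro y
        simp only [hfdef]
        split_ifs <;> ring
      simp_rw [h1, sum_add_distrib, sum_ite_mem, univ_inter, sum_const, card_univ, nsmul_eq_mul,
        ← hndef]
      field_simp
      ring
    rw [this]
    have : 0 ≤ (#B : ℝ) ^ 2 / n := by positivity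
    linarith
  have hPf : ∀ x, ((lsrwMatrix G ^ k) *ᵥ f) x = ∑ y ∈ B, (lsrwMatrix G ^ k) x y - #B / n := by
    intro x
    simp only [mulVec, dotProduct, hfdef, mul_sub, sum_sub_distrib, mul_ite, mul_one, mul_zero,
      sum_ite_mem, univ_inter, ← sum_mul, lsrwMatrix_pow_row_sum, one_mul]
  have hsum : ∑ x ∈ A, ∑ y ∈ B, (lsrwMatrix G ^ k) x y - (#A * #B : ℝ) / n
      = ∑ x ∈ A, ((lsrwMatrix G ^ k) *ᵥ f) x := by
    simp_rw [hPf, sum_sub_distrib, sum_const, nsmul_eq_mul]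
    ring
  rw [hsum]
  have h01 : 0 ≤ (1 - lam) ^ k := pow_nonneg (by linarith [h.le_one G hd hd0]) k
  have hcs : (∑ x ∈ A, ((lsrwMatrix G ^ k) *ᵥ f) x) ^ 2
      ≤ ((1 - lam) ^ k) ^ 2 * (#A * #B) := by
    calc _ ≤ #A * ∑ x ∈ A, ((lsrwMatrix G ^ k) *ᵥ f) x ^ 2 := sq_sum_le_card_mul_sum_sq
      _ ≤ #A * ∑ x, ((lsrwMatrix G ^ k) *ᵥ f) x ^ 2 := by
        gcongr
        exact subset_univ A
      _ ≤ #A * (((1 - lam) ^ k) ^ 2 * ∑ x, f x ^ 2) := by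
        gcongr
        exact (sum_sq_lsrwMatrix_pow_mulVec_le G hd hd0 hG h k f hf).2
      _ ≤ #A * (((1 - lam) ^ k) ^ 2 * #B) := by gcongr
      _ = _ := by ring
  refine abs_le_of_sq_le_sq ?_ (by positivity)
  rw [mul_pow, Real.sq_sqrt (by positivity)]
  exact hcs

end Spectral

/-! ### Path measure of a single walk and its Markov property. -/

/-- A set of trajectories which is determined by the positions up to time `b`. -/
def IsPast {V : Type*} (b : ℕ) (E : Set (ℕ → V)) : Prop :=
  ∀ X Y : ℕ → V, (∀ i ≤ b, X i = Y i) → X ∈ E → Y ∈ E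

section IsPast

variable {V : Type*} {b c : ℕ} {E F : Set (ℕ → V)}

theorem IsPast.mono (h : IsPast b E) (hbc : b ≤ c) : IsPast c E :=
  fun X Y hXY hX => h X Y (fun i hi => hXY i (hi.trans hbc)) hX

theorem IsPast.inter (hE : IsPast b E) (hF : IsPast b F) : IsPast b (E ∩ F) :=
  fun X Y hXY hX => ⟨hE X Y hXY hX.1, hF X Y hXY hX.2⟩

theorem isPast_univ : IsPast b (Set.univ : Set (ℕ → V)) := fun _ _ _ _ => trivial

theorem isPast_setOf_apply (p : V → Prop) : IsPast b {X : ℕ → V | p (X b)} :=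
  fun X Y hXY hX => by simpa [← hXY b le_rfl] using hX

theorem IsPast.eq_preimage (h : IsPast b E) :
    E = Preorder.frestrictLe (π := fun _ => V) b ⁻¹' (Preorder.frestrictLe b '' E) := by
  ext X
  constructor
  · exact fun hX => ⟨X, hX, rfl⟩
  · rintro ⟨Y, hY, hXY⟩
    exact h Y X (fun i hi => congrFun hXY ⟨i, Finset.mem_Iic.2 hi⟩) hY

theorem IsPast.measurableSet [Finite V] [MeasurableSpace V] [DiscreteMeasurableSpace V]
    (h : IsPast b E) : MeasurableSet E := by
  rw [h.eq_preimage]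
  exact Preorder.measurable_frestrictLe b (Set.toFinite _).measurableSet

end IsPast

theorem measureReal_eq_sum_inter {Ω V : Type*} [Fintype V] [MeasurableSpace V]
    [DiscreteMeasurableSpace V] [MeasurableSpace Ω] (μ : Measure Ω) [IsFiniteMeasure μ]
    {f : Ω → V} (hf : Measurable f) {E : Set Ω} (hE : MeasurableSet E) :
    μ.real E = ∑ x, μ.real (E ∩ {ω | f ω = x}) := by
  classical
  rw [← measureReal_biUnion_finset]
  · congr 1
    ext ω
    simp
  · intro x _ y _ hxy
    refine Set.disjoint_left.2 fun ω h1 h2 => hxy ?_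
    rw [← h1.2, ← h2.2]
  · intro x _
    exact hE.inter (hf (measurableSet_singleton x))

section Walk

variable {V : Type*} [Fintype V] [DecidableEq V] [MeasurableSpace V] [DiscreteMeasurableSpace V]
  (G : SimpleGraph V) [DecidableRel G.Adj] (v : V)

theorem lsrwKernel_singleton (x y : V) :
    lsrwKernel G x {y} = ENNReal.ofReal (lsrwMatrix G x y) := by
  change (∑ v, ENNReal.ofReal (lsrwMatrix G x v) • Measure.dirac v : Measure V) {y} = _
  simp only [Measure.coe_finsetSum, Finset.sum_apply, Measure.smul_apply, smul_eq_mul,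
    Measure.dirac_apply' _ (measurableSet_singleton y), Set.indicator_apply, Set.mem_singleton_iff,
    Pi.one_apply, mul_ite, mul_one, mul_zero, sum_ite_eq', mem_univ, if_true]

theorem lsrwLaw_real_start : (lsrwLaw G v).real {X | X 0 = v} = 1 := by
  have h1 : MeasurableSet {h : Iic 0 → V | h ⟨0, by simp⟩ = v} := (Set.toFinite _).measurableSet
  have h : (lsrwLaw G v) (Preorder.frestrictLe (π := fun _ => V) 0 ⁻¹'
      {h : Iic 0 → V | h ⟨0, by simp⟩ = v}) = 1 := by
    rw [← Measure.map_apply (Preorder.measurable_frestrictLe 0) h1, lsrwLaw,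
      Kernel.traj_map_frestrictLe_apply, Kernel.partialTraj_self, Kernel.id_apply,
      Measure.dirac_apply' _ h1]
    simp
  rw [measureReal_def]
  exact (congrArg ENNReal.toReal h).trans (by simp)

theorem ae_lsrwLaw_start : ∀ᵐ X ∂(lsrwLaw G v), X 0 = v := by
  have hm : MeasurableSet {X : ℕ → V | X 0 = v} :=
    (isPast_setOf_apply (b := 0) fun z => z = v).measurableSet
  refine (mem_ae_iff_prob_eq_one hm).2 ?_
  have := lsrwLaw_real_start G v
  rwa [measureReal_def, ENNReal.toReal_eq_one_iff] at this

theorem lsrwLaw_real_step {b : ℕ} {E : Set (ℕ → V)} (hE : IsPast b E) (x y : V) :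
    (lsrwLaw G v).real (E ∩ {X | X b = x} ∩ {X | X (b + 1) = y})
      = (lsrwLaw G v).real (E ∩ {X | X b = x}) * lsrwMatrix G x y := by
  have hF : IsPast b (E ∩ {X | X b = x}) := hE.inter (isPast_setOf_apply fun z => z = x)
  set F := E ∩ {X | X b = x} with hFdef
  set S : Set (Iic b → V) := Preorder.frestrictLe (π := fun _ => V) b '' F with hS
  have hSm : MeasurableSet S := (Set.toFinite _).measurableSet
  have key := Kernel.partialTraj_compProd_eq_map_traj (X := fun _ => V) (κ := lsrwStep G)
    (Nat.zero_le b) (x₀ := fun _ => v)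
  have h1 := DFunLike.congr_fun key (S ×ˢ {y})
  rw [Measure.map_apply (by fun_prop) (hSm.prod (measurableSet_singleton y)),
    Measure.compProd_apply_prod hSm (measurableSet_singleton y),
    ← Kernel.traj_map_frestrictLe_apply] at h1
  have h2 : ∫⁻ h in S, lsrwStep G b h {y} ∂((Kernel.traj (X := fun _ => V) (lsrwStep G) 0
      (fun _ => v)).map (Preorder.frestrictLe b))
      = ENNReal.ofReal (lsrwMatrix G x y) * (lsrwLaw G v) F := by
    rw [setLIntegral_congr_fun (g := fun _ => ENNReal.ofReal (lsrwMatrix G x y)) hSm,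
      setLIntegral_const, Measure.map_apply (Preorder.measurable_frestrictLe b) hSm,
      ← hF.eq_preimage]
    · rfl
    · rintro h ⟨X, hX, rfl⟩
      have : X b = x := hX.2
      simp only [lsrwStep, Kernel.comap_apply, lsrwKernel_singleton]
      rw [← this]
      rfl
  rw [h2] at h1
  have h3 : (fun X : ℕ → V => (Preorder.frestrictLe (π := fun _ => V) b X, X (b + 1)))
      ⁻¹' (S ×ˢ {y}) = F ∩ {X | X (b + 1) = y} := by
    conv_rhs => rw [hF.eq_preimage]
    ext X
    simp [hS]
  rw [h3] at h1
  rw [measureReal_def, measureReal_def, mul_comm]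
  change ((Kernel.traj (X := fun _ => V) (lsrwStep G) 0 (fun _ => v)) _).toReal = _
  rw [← h1, ENNReal.toReal_mul, ENNReal.toReal_ofReal (lsrwMatrix_nonneg G x y)]

/-- The Markov property of LSRW. -/
theorem lsrwLaw_real_steps {b : ℕ} {E : Set (ℕ → V)} (hE : IsPast b E) (k : ℕ) (x y : V) :
    (lsrwLaw G v).real (E ∩ {X | X b = x} ∩ {X | X (b + k) = y})
      = (lsrwLaw G v).real (E ∩ {X | X b = x}) * (lsrwMatrix G ^ k) x y := by
  have hF : IsPast b (E ∩ {X | X b = x}) := hE.inter (isPast_setOf_apply fun z => z = x)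
  induction k generalizing y with
  | zero =>
    by_cases hxy : x = y
    · subst hxy
      simp [Set.inter_assoc]
    · simp only [add_zero, pow_zero, one_apply, hxy, if_false, mul_zero]
      convert! measureReal_empty
      ext X
      simp only [Set.mem_inter_iff, Set.mem_ofPred_eq, Set.mem_empty_iff_false, iff_false]
      rintro ⟨⟨-, h1⟩, h2⟩
      exact hxy (h1.symm.trans h2)
  | succ k ih =>
    have hm : MeasurableSet {X : ℕ → V | X (b + (k + 1)) = y} :=
      (isPast_setOf_apply fun z => z = y).measurableSet
    rw [measureReal_eq_sum_inter _ (measurable_pi_apply (b + k)) (hF.measurableSet.inter hm),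
      pow_succ, mul_apply, mul_sum]
    refine sum_congr rfl fun z _ => ?_
    rw [Set.inter_right_comm, ← add_assoc, lsrwLaw_real_step G v (hF.mono (Nat.le_add_right b k)),
      ih z, mul_assoc]

theorem lsrwLaw_real_marginal (k : ℕ) (y : V) :
    (lsrwLaw G v).real {X | X k = y} = (lsrwMatrix G ^ k) v y := by
  have h := lsrwLaw_real_steps G v (b := 0) isPast_univ k v y
  rw [Set.univ_inter, lsrwLaw_real_start, one_mul, zero_add] at h
  rw [← h]
  refine measureReal_congr ?_
  filter_upwards [ae_lsrwLaw_start G v] with X hX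
  exact propext ⟨fun h => ⟨hX, h⟩, fun h => h.2⟩

theorem lsrwLaw_real_pair (s k : ℕ) (x y : V) :
    (lsrwLaw G v).real ({X | X s = x} ∩ {X | X (s + k) = y})
      = (lsrwMatrix G ^ s) v x * (lsrwMatrix G ^ k) x y := by
  have h := lsrwLaw_real_steps G v (b := s) isPast_univ k x y
  rwa [Set.univ_inter, lsrwLaw_real_marginal] at h

theorem lsrwLaw_real_inter_le {b k : ℕ} {E : Set (ℕ → V)} (hE : IsPast b E) {S : Finset V} {β : ℝ}
    (hβ : ∀ x, ∑ y ∈ S, (lsrwMatrix G ^ k) x y ≤ β) :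
    (lsrwLaw G v).real (E ∩ {X | X (b + k) ∈ S}) ≤ (lsrwLaw G v).real E * β := by
  have hm : MeasurableSet {X : ℕ → V | X (b + k) ∈ S} :=
    (isPast_setOf_apply fun z => z ∈ S).measurableSet
  rw [measureReal_eq_sum_inter _ (measurable_pi_apply b) (hE.measurableSet.inter hm),
    measureReal_eq_sum_inter _ (measurable_pi_apply b) hE.measurableSet, sum_mul]
  refine sum_le_sum fun x _ => ?_
  rw [Set.inter_right_comm]
  have : E ∩ {X | X b = x} ∩ {X | X (b + k) ∈ S}
      = ⋃ y ∈ S, E ∩ {X | X b = x} ∩ {X | X (b + k) = y} := by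
    ext X
    simp
  rw [this]
  refine (measureReal_biUnion_finset_le _ _).trans ?_
  simp_rw [lsrwLaw_real_steps G v hE, ← mul_sum]
  exact mul_le_mul_of_nonneg_left (hβ x) measureReal_nonneg

/-- The last time is peeled off by the Markov property: whatever happened before, at least `g` steps
remain to reach it. -/
theorem lsrwLaw_real_forall_mem_le {g : ℕ} {τ : ℕ → ℕ} (hτ0 : g ≤ τ 0)
    (hτ : ∀ i, τ i + g ≤ τ (i + 1)) {S : ℕ → Finset V} {β : ℕ → ℝ}
    (hβ : ∀ i k, g ≤ k → ∀ x, ∑ y ∈ S i, (lsrwMatrix G ^ k) x y ≤ β i) (B : ℕ) :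
    (lsrwLaw G v).real {X | ∀ i < B, X (τ i) ∈ S i} ≤ ∏ i ∈ range B, β i := by
  have hβ0 : ∀ i, 0 ≤ β i := fun i =>
    (sum_nonneg fun y _ => lsrwMatrix_pow_nonneg G g v y).trans (hβ i g le_rfl v)
  have hpast : ∀ B, IsPast (τ B) {X : ℕ → V | ∀ i < B + 1, X (τ i) ∈ S i} := by
    have hmono : Monotone τ := monotone_nat_of_le_succ fun i => (Nat.le_add_right _ _).trans (hτ i)
    intro B X Y hXY hX i hi
    rw [← hXY _ (hmono (Nat.lt_succ_iff.1 hi))]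
    exact hX i hi
  induction B with
  | zero => simp
  | succ B ih =>
    rw [prod_range_succ]
    have hsplit : {X : ℕ → V | ∀ i < B + 1, X (τ i) ∈ S i}
        = {X | ∀ i < B, X (τ i) ∈ S i} ∩ {X | X (τ B) ∈ S B} := by
      ext X
      exact Nat.forall_lt_succ_right
    rw [hsplit]
    refine le_trans ?_ (mul_le_mul_of_nonneg_right ih (hβ0 B))
    -- The gap before `τ 0` is measured from time 0, later gaps from the preceding `τ`.
    cases B with
    | zero =>
      obtain ⟨k, hk⟩ := Nat.exists_eq_add_of_le (Nat.zero_le (τ 0))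
      have := lsrwLaw_real_inter_le G v (b := 0) (k := k) (E := {X | ∀ i < 0, X (τ i) ∈ S i})
        (fun _ _ _ _ i hi => absurd hi (Nat.not_lt_zero i)) (hβ 0 k (by omega))
      rwa [← hk] at this
    | succ B =>
      obtain ⟨k, hk⟩ := Nat.exists_eq_add_of_le ((Nat.le_add_right _ _).trans (hτ B))
      have := lsrwLaw_real_inter_le G v (b := τ B) (k := k) (hpast B)
        (hβ (B + 1) k (by have := hτ B; omega))
      rwa [← hk] at this

end Walk

/-! ### Conditioning on finitely many coordinates of a product measure. -/

section Product

variable {W Ω Λ : Type*} [MeasurableSpace Ω] (μ : W → Measure Ω) [∀ w, IsProbabilityMeasure (μ w)]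

theorem infinitePi_real_forall_mem (D : Finset W) {C : W → Set Ω}
    (hC : ∀ w ∈ D, MeasurableSet (C w)) :
    (Measure.infinitePi μ).real {ω | ∀ w ∈ D, ω w ∈ C w} = ∏ w ∈ D, (μ w).real (C w) := by
  have h : {ω : W → Ω | ∀ w ∈ D, ω w ∈ C w} = Set.pi D C := rfl
  rw [h, measureReal_def, Measure.infinitePi_pi μ hC, ENNReal.toReal_prod]
  rfl

variable [DecidableEq W] [Fintype Λ] [MeasurableSpace Λ] [DiscreteMeasurableSpace Λ]

/-- Conditioning on a finite-valued statistic of the coordinates in `D₁` freezes the constraint on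
those in `D₂`, which are independent of it. -/
theorem infinitePi_real_forall_mem_eq_sum {D₁ D₂ : Finset W} (hD : Disjoint D₁ D₂) {f : Ω → Λ}
    (hf : Measurable f) {R : (D₁ → Λ) → W → Set Ω} (hR : ∀ g w, MeasurableSet (R g w)) :
    (Measure.infinitePi μ).real {ω | ∀ w ∈ D₂, ω w ∈ R (fun w => f (ω w)) w}
      = ∑ g : D₁ → Λ, (Measure.infinitePi μ).real {ω | (fun w : D₁ => f (ω w)) = g}
        * ∏ w ∈ D₂, (μ w).real (R g w) := by
  have hF : Measurable fun (ω : W → Ω) (w : D₁) => f (ω w) := by fun_prop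
  have hE : {ω : W → Ω | ∀ w ∈ D₂, ω w ∈ R (fun w => f (ω w)) w} = ⋃ g : D₁ → Λ,
      {ω : W → Ω | (fun w : D₁ => f (ω w)) = g} ∩ {ω | ∀ w ∈ D₂, ω w ∈ R g w} := by
    ext ω
    simp
  have hm : ∀ g, MeasurableSet {ω : W → Ω | ∀ w ∈ D₂, ω w ∈ R g w} := fun g =>
    MeasurableSet.pi D₂.countable_toSet fun w _ => hR g w
  have hm' : ∀ g, MeasurableSet {ω : W → Ω | (fun w : D₁ => f (ω w)) = g} := fun g =>
    hF (measurableSet_singleton g)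
  rw [measureReal_eq_sum_inter _ hF]
  swap
  · rw [hE]
    exact MeasurableSet.iUnion fun g => (hm' g).inter (hm g)
  refine sum_congr rfl fun g _ => ?_
  -- With `g` fixed, the joint event is a box with sides `C w`.
  let C : W → Set Ω := fun w => if h : w ∈ D₁ then f ⁻¹' {g ⟨w, h⟩} else R g w
  have hC1 : ∀ w : D₁, C w = f ⁻¹' {g w} := fun w => by simp [C]
  have hC2 : ∀ w ∈ D₂, C w = R g w := fun w hw => by
    have : w ∉ D₁ := fun h => disjoint_left.1 hD h hw
    simp [C, this]
  have hC : ∀ w, MeasurableSet (C w) := by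
    intro w
    by_cases h : w ∈ D₁
    · rw [hC1 ⟨w, h⟩]
      exact hf (measurableSet_singleton _)
    · simp only [C, h, dite_false]
      exact hR g w
  have e1 : {ω : W → Ω | (fun w : D₁ => f (ω w)) = g} = {ω | ∀ w ∈ D₁, ω w ∈ C w} := by
    ext ω
    simp only [Set.mem_ofPred_eq, funext_iff]
    exact ⟨fun h w hw => by rw [hC1 ⟨w, hw⟩]; exact h ⟨w, hw⟩,
      fun h w => by have := h w w.2; rwa [hC1 w] at this⟩
  have e2 : {ω : W → Ω | ∀ w ∈ D₂, ω w ∈ R (fun w => f (ω w)) w} ∩ {ω | (fun w : D₁ => f (ω w)) = g}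
      = {ω | ∀ w ∈ D₁ ∪ D₂, ω w ∈ C w} := by
    ext ω
    simp only [mem_union, or_imp, forall_and]
    constructor
    · rintro ⟨h1, h2⟩
      have h3 : ω ∈ {ω | ∀ w ∈ D₁, ω w ∈ C w} := by rw [← e1]; exact h2
      refine ⟨h3, fun w hw => ?_⟩
      rw [hC2 w hw, ← show _ = g from h2]
      exact h1 w hw
    · rintro ⟨h1, h2⟩
      have h3 : (fun w : D₁ => f (ω w)) = g := by
        have : ω ∈ {ω : W → Ω | ∀ w ∈ D₁, ω w ∈ C w} := h1
        rwa [← e1] at this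
      refine ⟨fun w hw => ?_, h3⟩
      rw [h3, ← hC2 w hw]
      exact h2 w hw
  rw [e2, e1, infinitePi_real_forall_mem μ _ fun w _ => hC w,
    infinitePi_real_forall_mem μ _ fun w _ => hC w, prod_union hD]
  congr 1
  exact prod_congr rfl fun w hw => by rw [hC2 w hw]

end Product

theorem integral_pow_poissonMeasure_one (q : ℝ) :
    ∫ n, q ^ n ∂(poissonMeasure 1) = Real.exp (-(1 - q)) := by
  rw [integral_poissonMeasure]
  have h := (NormedSpace.expSeries_div_hasSum_exp q).mul_left (Real.exp (-1))
  rw [← Real.exp_eq_exp_ℝ, ← Real.exp_add] at h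
  rw [show -(1 - q) = -1 + q by ring, ← h.tsum_eq]
  refine tsum_congr fun n => ?_
  simp
  ring

theorem prod_measureReal_eq_integral {α β : Type*} [MeasurableSpace α] [MeasurableSpace β]
    (μ : Measure α) (ν : Measure β) [IsFiniteMeasure μ] [IsFiniteMeasure ν] {E : Set (α × β)}
    (hE : MeasurableSet E) : (μ.prod ν).real E = ∫ x, ν.real (Prod.mk x ⁻¹' E) ∂μ := by
  rw [measureReal_def, Measure.prod_apply hE, integral_eq_lintegral_of_nonneg_ae]
  · congr 1
    exact lintegral_congr fun x => by simp [measureReal_def]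
  · exact Filter.Eventually.of_forall fun x => measureReal_nonneg
  · exact (measurable_measure_prodMk_left hE).ennreal_toReal.aestronglyMeasurable

/-! ### The Poisson system of walkers. -/

section Model

theorem initialDensity_eq_one {V : Type*} [Fintype V] [DecidableEq V] (G : SimpleGraph V)
    [DecidableRel G.Adj] {d : ℕ} (hd : G.IsRegularOfDegree d) (hd0 : d ≠ 0) (v : V) :
    initialDensity G v = 1 := by
  have h := G.sum_degrees_eq_twice_card_edges
  simp only [hd.degree_eq, sum_const, card_univ, smul_eq_mul] at h
  have h' : (Fintype.card V : ℝ≥0) * d = 2 * (G.edgeFinset.card : ℝ≥0) := by exact_mod_cast h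
  have hn : (Fintype.card V : ℝ≥0) ≠ 0 := by
    have : Nonempty V := ⟨v⟩
    exact_mod_cast Fintype.card_ne_zero
  have hd' : (d : ℝ≥0) ≠ 0 := by exact_mod_cast hd0
  rw [initialDensity, hd.degree_eq, ← h']
  field_simp

variable {V : Type*} [Fintype V] [DecidableEq V] [MeasurableSpace V] [DiscreteMeasurableSpace V]
  (G : SimpleGraph V) [DecidableRel G.Adj] {d : ℕ}

/-- The law of the trajectories of all potential walkers. -/
noncomputable def walkersLaw : Measure (V × ℕ → ℕ → V) :=
  Measure.infinitePi fun w : V × ℕ => lsrwLaw G w.1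

instance : IsProbabilityMeasure (walkersLaw G) := by
  unfold walkersLaw; infer_instance

instance : IsProbabilityMeasure (snLaw G) := by
  unfold snLaw; infer_instance

theorem snLaw_real_snd {E : Set (V × ℕ → ℕ → V)} :
    (snLaw G).real {ω | ω.2 ∈ E} = (walkersLaw G).real E := by
  have : {ω : Config V | ω.2 ∈ E} = Set.univ ×ˢ E := by ext; simp
  rw [this, snLaw, measureReal_prod_prod]
  simp [walkersLaw]

variable {Λ : Type*} [Fintype Λ] [MeasurableSpace Λ] [DiscreteMeasurableSpace Λ]

/-- The first walkers starting at the vertices of `U`. -/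
def firstWalkers (U : Finset V) : Finset (V × ℕ) := U.image fun u => (u, 0)

/-- Poisson thinning. Given `g`, a vertex `v` outside `U` contributes `q ^ N` with `N` Poisson of
mean 1, whose expectation is `exp (-(1 - q))`. The first walkers from `U` enter as potential
walkers, whether or not they are present. -/
theorem snLaw_real_forall_mem_eq_sum (hd : G.IsRegularOfDegree d) (hd0 : d ≠ 0) (U : Finset V)
    {f : (ℕ → V) → Λ} (hf : Measurable f) {R : (firstWalkers U → Λ) → Set (ℕ → V)}
    (hR : ∀ g, MeasurableSet (R g)) :
    (snLaw G).real {ω | ∀ v ∉ U, ∀ i < ω.1 v, ω.2 (v, i) ∈ R (fun w => f (ω.2 w))}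
      = ∑ g : firstWalkers U → Λ,
        (walkersLaw G).real {ω | (fun w : firstWalkers U => f (ω w)) = g}
        * Real.exp (-∑ v ∈ Uᶜ, (1 - (lsrwLaw G v).real (R g))) := by
  have hF : Measurable fun (ω : Config V) (w : firstWalkers U) => f (ω.2 w) := by fun_prop
  have hm : MeasurableSet
      {ω : Config V | ∀ v ∉ U, ∀ i < ω.1 v, ω.2 (v, i) ∈ R (fun w => f (ω.2 w))} := by
    have : {ω : Config V | ∀ v ∉ U, ∀ i < ω.1 v, ω.2 (v, i) ∈ R (fun w => f (ω.2 w))}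
        = ⋂ (v : V) (_ : v ∉ U) (i : ℕ), {ω | ω.1 v ≤ i} ∪ ⋃ g : firstWalkers U → Λ,
          {ω | (fun w : firstWalkers U => f (ω.2 w)) = g} ∩ {ω | ω.2 (v, i) ∈ R g} := by
      ext ω
      simp only [Set.mem_ofPred_eq, Set.mem_iInter, Set.mem_union, Set.mem_iUnion, Set.mem_inter_iff,
        exists_eq_left']
      refine forall₃_congr fun v _ i => ?_
      rw [← not_lt, imp_iff_not_or]
    rw [this]
    refine MeasurableSet.iInter fun v => MeasurableSet.iInter fun _ => MeasurableSet.iInter fun i =>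
      MeasurableSet.union ?_ (MeasurableSet.iUnion fun g => MeasurableSet.inter ?_ ?_)
    · have : Measurable fun ω : Config V => ω.1 v := by fun_prop
      exact this (Set.to_countable (Set.Iic i)).measurableSet
    · exact hF (measurableSet_singleton g)
    · have : Measurable fun ω : Config V => ω.2 (v, i) := by fun_prop
      exact this (hR g)
  rw [snLaw, prod_measureReal_eq_integral _ _ hm]
  have key : ∀ ν : V → ℕ, (Measure.infinitePi fun w : V × ℕ => lsrwLaw G w.1).real
      (Prod.mk ν ⁻¹' {ω : Config V | ∀ v ∉ U, ∀ i < ω.1 v, ω.2 (v, i) ∈ R (fun w => f (ω.2 w))})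
      = ∑ g : firstWalkers U → Λ,
        (walkersLaw G).real {ω | (fun w : firstWalkers U => f (ω w)) = g}
        * ∏ v : V, (if v ∈ U then 1 else (lsrwLaw G v).real (R g)) ^ ν v := by
    intro ν
    let D : Finset (V × ℕ) := Uᶜ.biUnion fun v => (range (ν v)).image fun i => (v, i)
    have hD : Disjoint (firstWalkers U) D := by
      rw [disjoint_left]
      rintro ⟨v, i⟩ h1 h2
      simp only [firstWalkers, mem_image, Prod.mk.injEq] at h1
      simp only [D, mem_biUnion, mem_compl, mem_image, Prod.mk.injEq] at h2
      obtain ⟨u, hu, rfl, -⟩ := h1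
      obtain ⟨u', hu', i', -, rfl, -⟩ := h2
      exact hu' hu
    have := infinitePi_real_forall_mem_eq_sum (fun w : V × ℕ => lsrwLaw G w.1) hD hf
      (R := fun g _ => R g) (fun g _ => hR g)
    refine Eq.trans ?_ (this.trans ?_)
    · congr 1
      ext ω
      simp only [D, Set.mem_preimage, Set.mem_ofPred_eq, mem_biUnion, mem_compl, mem_image,
        mem_range, forall_exists_index, and_imp]
      constructor
      · rintro h _ v hv i hi rfl
        exact h v hv i hi
      · exact fun h v hv i hi => h _ v hv i hi rfl
    · refine sum_congr rfl fun g _ => ?_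
      congr 1
      rw [prod_biUnion]
      · rw [← prod_subset (subset_univ Uᶜ)]
        · refine prod_congr rfl fun v hv => ?_
          rw [prod_image (by simp), if_neg (mem_compl.1 hv)]
          simp
        · intro v _ hv
          simp only [mem_compl, not_not] at hv
          simp [hv]
      · intro v _ v' _ hvv
        simp only [Function.onFun, disjoint_left, mem_image, not_exists, not_and]
        rintro _ ⟨i, -, rfl⟩ j _ h
        exact hvv (Prod.mk.inj h).1.symm
  simp_rw [key]
  rw [integral_finsetSum]
  · refine sum_congr rfl fun g _ => ?_
    rw [integral_const_mul, integral_fintype_prod_eq_prod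
      (f := fun v n => (if v ∈ U then 1 else (lsrwLaw G v).real (R g)) ^ n)]
    congr 1
    rw [← sum_neg_distrib, Real.exp_sum, ← prod_subset (subset_univ Uᶜ)]
    · refine prod_congr rfl fun v hv => ?_
      rw [initialDensity_eq_one G hd hd0, if_neg (mem_compl.1 hv), integral_pow_poissonMeasure_one]
    · intro v _ hv
      simp only [mem_compl, not_not] at hv
      simp [hv]
  · intro g _
    refine Integrable.const_mul ?_ _
    refine Integrable.of_bound (C := 1) (Measurable.of_discrete.aestronglyMeasurable)
      (Filter.Eventually.of_forall fun ν => ?_)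
    rw [Real.norm_of_nonneg]
    · refine prod_le_one (fun v _ => ?_) fun v _ => pow_le_one₀ ?_ ?_
      · split_ifs <;> positivity
      · split_ifs <;> positivity
      · split_ifs
        · exact le_rfl
        · exact measureReal_le_one
    · refine prod_nonneg fun v _ => ?_
      split_ifs <;> positivity

/-- Splits a conditional probability `K` over the bad values of `g`, where it is at most 1, and the
good ones, where it is at most `κ`. -/
theorem sum_walkersLaw_real_mul_le (U : Finset V) {f : (ℕ → V) → Λ} (hf : Measurable f)
    {bad : (firstWalkers U → Λ) → Prop} {K : (firstWalkers U → Λ) → ℝ} {κ : ℝ}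
    (hκ : 0 ≤ κ) (hK1 : ∀ g, K g ≤ 1) (hK : ∀ g, ¬ bad g → K g ≤ κ) :
    ∑ g : firstWalkers U → Λ,
        (walkersLaw G).real {ω | (fun w : firstWalkers U => f (ω w)) = g} * K g
      ≤ (walkersLaw G).real {ω | bad fun w : firstWalkers U => f (ω w)} + κ := by
  classical
  have hF : Measurable fun (ω : V × ℕ → ℕ → V) (w : firstWalkers U) => f (ω w) := by fun_prop
  have h1 : ∀ T : Finset (firstWalkers U → Λ),
      ∑ g ∈ T, (walkersLaw G).real {ω | (fun w : firstWalkers U => f (ω w)) = g}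
      = (walkersLaw G).real {ω | (fun w : firstWalkers U => f (ω w)) ∈ T} := by
    intro T
    exact sum_measureReal_preimage_singleton T (fun g _ => hF (measurableSet_singleton g))
  calc _ ≤ ∑ g : firstWalkers U → Λ,
        ((if bad g then (walkersLaw G).real {ω | (fun w : firstWalkers U => f (ω w)) = g} else 0)
          + (walkersLaw G).real {ω | (fun w : firstWalkers U => f (ω w)) = g} * κ) := by
        refine sum_le_sum fun g _ => ?_
        have h0 : 0 ≤ (walkersLaw G).real {ω | (fun w : firstWalkers U => f (ω w)) = g} :=
          measureReal_nonneg
        split_ifs with hb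
        · nlinarith [hK1 g, mul_nonneg h0 hκ, mul_le_mul_of_nonneg_left (hK1 g) h0]
        · rw [zero_add]
          exact mul_le_mul_of_nonneg_left (hK g hb) h0
    _ = _ := by
        rw [sum_add_distrib, ← sum_mul, h1 univ, ← sum_filter, h1]
        simp

end Model

/-! ### Second moment method and quantitative mixing. -/

theorem sum_half_pow_dist_le (S : Finset ℕ) (s : ℕ) :
    ∑ t ∈ S, (1 / 2 : ℝ) ^ ((s - t) + (t - s)) ≤ 4 := by
  have key : ∀ (T : Finset ℕ) (φ : ℕ → ℕ), Set.InjOn φ T →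
      ∑ t ∈ T, (1 / 2 : ℝ) ^ φ t ≤ 2 := by
    intro T φ hφ
    rw [← sum_image (f := fun i => (1 / 2 : ℝ) ^ i) hφ]
    refine (summable_geometric_two.sum_le_tsum _ fun i _ => ?_).trans_eq tsum_geometric_two
    positivity
  rw [← sum_filter_add_sum_filter_not S (fun t => s ≤ t)]
  have h1 := key (S.filter fun t => s ≤ t) (fun t => (s - t) + (t - s)) (by
    intro a ha b hb hab
    simp only [coe_filter, Set.mem_ofPred_eq] at ha hb hab
    omega)
  have h2 := key (S.filter fun t => ¬ s ≤ t) (fun t => (s - t) + (t - s)) (by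
    intro a ha b hb hab
    simp only [coe_filter, Set.mem_ofPred_eq] at ha hb hab
    omega)
  linarith

/-- A Bonferroni-type inequality, from `1_{N = 0} ≤ (1 - a N) ^ 2`. -/
theorem measureReal_forall_notMem_le {Ω ι : Type*} [MeasurableSpace Ω] (μ : Measure Ω)
    [IsProbabilityMeasure μ] (S : Finset ι) {E : ι → Set Ω} (hE : ∀ i, MeasurableSet (E i)) (a : ℝ) :
    μ.real {ω | ∀ i ∈ S, ω ∉ E i} ≤ 1 - 2 * a * ∑ i ∈ S, μ.real (E i)
      + a ^ 2 * ∑ i ∈ S, ∑ j ∈ S, μ.real (E i ∩ E j) := by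
  let e : ι → Ω → ℝ := fun i => (E i).indicator 1
  have he : ∀ i, Integrable (e i) μ := fun i => (integrable_const 1).indicator (hE i)
  have he2 : ∀ i j, Integrable (fun ω => e i ω * e j ω) μ := by
    intro i j
    have : (fun ω => e i ω * e j ω) = (E i ∩ E j).indicator 1 := by
      ext ω
      simp [e, Set.inter_indicator_one]
    rw [this]
    exact (integrable_const 1).indicator ((hE i).inter (hE j))
  have hI1 : ∀ i, ∫ ω, e i ω ∂μ = μ.real (E i) := fun i => integral_indicator_one (hE i)
  have hI2 : ∀ i j, ∫ ω, e i ω * e j ω ∂μ = μ.real (E i ∩ E j) := by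
    intro i j
    rw [← integral_indicator_one ((hE i).inter (hE j)), Set.inter_indicator_one]
    rfl
  have hm : MeasurableSet {ω | ∀ i ∈ S, ω ∉ E i} := by
    have : {ω | ∀ i ∈ S, ω ∉ E i} = ⋂ i ∈ S, (E i)ᶜ := by ext; simp
    rw [this]
    exact Finset.measurableSet_biInter S fun i _ => (hE i).compl
  have hint : Integrable (fun ω => 1 - 2 * a * ∑ i ∈ S, e i ω
      + a ^ 2 * ∑ i ∈ S, ∑ j ∈ S, e i ω * e j ω) μ := by
    refine ((integrable_const 1).sub ((integrable_finsetSum S fun i _ => he i).const_mul _)).add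
      ((integrable_finsetSum S fun i _ => integrable_finsetSum S fun j _ => he2 i j).const_mul _)
  have hval : ∫ ω, (1 - 2 * a * ∑ i ∈ S, e i ω + a ^ 2 * ∑ i ∈ S, ∑ j ∈ S, e i ω * e j ω) ∂μ
      = 1 - 2 * a * ∑ i ∈ S, μ.real (E i) + a ^ 2 * ∑ i ∈ S, ∑ j ∈ S, μ.real (E i ∩ E j) := by
    rw [integral_add, integral_sub, integral_const_mul, integral_const_mul, integral_finsetSum,
      integral_finsetSum]
    · simp only [hI1, integral_const, probReal_univ, smul_eq_mul, mul_one]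
      congr 2
      refine sum_congr rfl fun i _ => ?_
      rw [integral_finsetSum _ fun j _ => he2 i j]
      simp only [hI2]
    · exact fun i _ => integrable_finsetSum S fun j _ => he2 i j
    · exact fun i _ => he i
    · exact integrable_const 1
    · exact (integrable_finsetSum S fun i _ => he i).const_mul _
    · exact (integrable_const 1).sub ((integrable_finsetSum S fun i _ => he i).const_mul _)
    · exact (integrable_finsetSum S fun i _ =>
        integrable_finsetSum S fun j _ => he2 i j).const_mul _
  rw [← hval, ← integral_indicator_one hm]
  refine integral_mono ((integrable_const 1).indicator hm) hint fun ω => ?_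
  have hsq : 1 - 2 * a * ∑ i ∈ S, e i ω + a ^ 2 * ∑ i ∈ S, ∑ j ∈ S, e i ω * e j ω
      = (1 - a * ∑ i ∈ S, e i ω) ^ 2 := by
    rw [← sum_mul_sum]
    ring
  simp only
  rw [hsq]
  by_cases hω : ω ∈ {ω | ∀ i ∈ S, ω ∉ E i}
  · have : ∑ i ∈ S, e i ω = 0 := sum_eq_zero fun i hi => Set.indicator_of_notMem (hω i hi) _
    simp [Set.indicator_of_mem hω, this]
  · rw [Set.indicator_of_notMem hω]
    exact sq_nonneg _

/-- `J` steps of LSRW contract the space of functions of mean zero by a factor `2`, and after `J * L`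
steps the transition probabilities are uniform up to a factor `2`. -/
structure Mixes {V : Type*} [Fintype V] [DecidableEq V] (G : SimpleGraph V) [DecidableRel G.Adj]
    (J L : ℕ) : Prop where
  le_pow : ∀ k, J * L ≤ k → ∀ x y, 1 / (2 * (Fintype.card V : ℝ)) ≤ (lsrwMatrix G ^ k) x y
  pow_le : ∀ k, J * L ≤ k → ∀ x y, (lsrwMatrix G ^ k) x y ≤ 2 / (Fintype.card V : ℝ)
  sum_pow_le : ∀ (k : ℕ) (A B : Finset V), ∑ x ∈ A, ∑ y ∈ B, (lsrwMatrix G ^ (J * k)) x y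
    ≤ (#A * #B : ℝ) / Fintype.card V + (1 / 2) ^ k * √(#A * #B)

theorem exp_neg_one_le_half : Real.exp (-1) ≤ 1 / 2 := by
  rw [Real.exp_neg, one_div]
  exact inv_anti₀ (by norm_num) (by linarith [Real.add_one_le_exp 1])

/-- From `(1 - lam) ^ k ≤ exp (-lam k)`: `J` steps give a factor `exp (-1) ≤ 1 / 2`, and `J * L`
steps give at most `1 / (2n)`. The pointwise bounds are the mixing lemma for singletons. -/
theorem IsExpander.mixes {V : Type*} [Fintype V] [DecidableEq V] (G : SimpleGraph V)
    [DecidableRel G.Adj] {d : ℕ} {lam : ℝ} (hd : G.IsRegularOfDegree d) (hd0 : d ≠ 0)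
    (hG : G.Connected) (hlam : 0 < lam) (h : IsExpander G lam) {J L : ℕ} (hJ : 1 ≤ lam * J)
    (hL : Real.log (2 * Fintype.card V) ≤ L) : Mixes G J L := by
  have hne : Nonempty V := hG.nonempty
  have hn : (0 : ℝ) < Fintype.card V := by exact_mod_cast Fintype.card_pos
  set n : ℝ := (Fintype.card V : ℝ) with hndef
  have h1 := h.le_one G hd hd0
  have hpow : ∀ k : ℕ, (1 - lam) ^ k ≤ Real.exp (-(lam * k)) := by
    intro k
    calc (1 - lam) ^ k ≤ Real.exp (-lam) ^ k :=
          pow_le_pow_left₀ (by linarith) (Real.one_sub_le_exp_neg lam) k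
      _ = _ := by rw [← Real.exp_nat_mul]; congr 1; ring
  have hpt : ∀ k, J * L ≤ k → ∀ x y, |(lsrwMatrix G ^ k) x y - 1 / n| ≤ 1 / (2 * n) := by
    intro k hk x y
    have h2 := abs_sum_lsrwMatrix_pow_sub_le G hd hd0 hG h k {x} {y}
    simp only [sum_singleton, card_singleton, Nat.cast_one, mul_one, Real.sqrt_one] at h2
    refine h2.trans ((hpow k).trans ?_)
    have h3 : Real.exp (-Real.log (2 * n)) = 1 / (2 * n) := by
      rw [Real.exp_neg, Real.exp_log (by positivity), one_div]
    rw [← h3]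
    refine Real.exp_le_exp.2 (neg_le_neg ?_)
    have h4 : (J * L : ℝ) ≤ k := by exact_mod_cast hk
    calc Real.log (2 * n) ≤ 1 * L := by simpa using hL
      _ ≤ lam * J * L := by gcongr
      _ = lam * (J * L) := by ring
      _ ≤ lam * k := by gcongr
  have e : 1 / n = 1 / (2 * n) + 1 / (2 * n) := by field_simp; norm_num
  have e' : 2 / n = 1 / n + 1 / n := by ring
  have e'' : 0 < 1 / (2 * n) := by positivity
  refine ⟨fun k hk x y => ?_, fun k hk x y => ?_, fun k A B => ?_⟩
  · have := (abs_le.1 (hpt k hk x y)).1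
    linarith
  · have := (abs_le.1 (hpt k hk x y)).2
    linarith
  · have h2 := (abs_le.1 (abs_sum_lsrwMatrix_pow_sub_le G hd hd0 hG h (J * k) A B)).2
    have h3 : (1 - lam) ^ (J * k) ≤ (1 / 2) ^ k := by
      rw [pow_mul]
      refine pow_le_pow_left₀ (pow_nonneg (by linarith) _) ?_ k
      exact (hpow J).trans ((Real.exp_le_exp.2 (by linarith)).trans exp_neg_one_le_half)
    have h4 : (1 - lam) ^ (J * k) * √(#A * #B) ≤ (1 / 2) ^ k * √(#A * #B) := by gcongr
    linarith

/-! ### Hitting moving sets, and the spread of independent walkers. -/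

section Walk

variable {V : Type*} [Fintype V] [DecidableEq V] [MeasurableSpace V] [DiscreteMeasurableSpace V]
  (G : SimpleGraph V) [DecidableRel G.Adj] {d J L : ℕ}

theorem lsrwLaw_real_mem (v : V) (s : ℕ) (A : Finset V) :
    (lsrwLaw G v).real {X | X s ∈ A} = ∑ x ∈ A, (lsrwMatrix G ^ s) v x := by
  simp_rw [← lsrwLaw_real_marginal]
  exact (sum_measureReal_preimage_singleton A
    (fun x _ => measurable_pi_apply s (measurableSet_singleton x))).symm

theorem measurableSet_setOf_apply_mem {V : Type*} [Finite V] [MeasurableSpace V]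
    [DiscreteMeasurableSpace V] (s : ℕ) (A : Finset V) :
    MeasurableSet {X : ℕ → V | X s ∈ A} :=
  (isPast_setOf_apply fun z => z ∈ A).measurableSet

/-- Summing over all starting vertices makes the position at time `s` stationary, so only the lag
`k` remains. -/
theorem sum_lsrwLaw_real_pair_le (hd : G.IsRegularOfDegree d) (s k : ℕ) (A B : Finset V) :
    ∑ v, (lsrwLaw G v).real ({X | X s ∈ A} ∩ {X | X (s + k) ∈ B})
      ≤ ∑ x ∈ A, ∑ y ∈ B, (lsrwMatrix G ^ k) x y := by
  have h : ∀ v, (lsrwLaw G v).real ({X | X s ∈ A} ∩ {X | X (s + k) ∈ B})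
      ≤ ∑ x ∈ A, ∑ y ∈ B, (lsrwMatrix G ^ s) v x * (lsrwMatrix G ^ k) x y := by
    intro v
    simp_rw [← lsrwLaw_real_pair]
    have : {X : ℕ → V | X s ∈ A} ∩ {X | X (s + k) ∈ B}
        = ⋃ x ∈ A, ⋃ y ∈ B, {X : ℕ → V | X s = x} ∩ {X | X (s + k) = y} := by
      ext X
      simp
    rw [this]
    exact (measureReal_biUnion_finset_le _ _).trans
      (sum_le_sum fun x _ => measureReal_biUnion_finset_le _ _)
  refine (sum_le_sum fun v _ => h v).trans (le_of_eq ?_)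
  rw [sum_comm]
  refine sum_congr rfl fun x _ => ?_
  rw [sum_comm]
  refine sum_congr rfl fun y _ => ?_
  rw [← sum_mul, lsrwMatrix_pow_col_sum G hd, one_mul]

theorem Mixes.sum_lsrwLaw_real_inter_le (hM : Mixes G J L) (hd : G.IsRegularOfDegree d)
    {m : ℕ} {A : ℕ → Finset V} (hA : ∀ s, #(A s) ≤ m) (s t : ℕ) :
    ∑ v, (lsrwLaw G v).real ({X | X (J * s) ∈ A s} ∩ {X | X (J * t) ∈ A t})
      ≤ (m : ℝ) ^ 2 / Fintype.card V + (1 / 2) ^ ((s - t) + (t - s)) * m := by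
  wlog hst : s ≤ t generalizing s t
  · simp_rw [Set.inter_comm {X : ℕ → V | X (J * s) ∈ A s}]
    rw [add_comm (s - t)]
    exact this t s (by omega)
  obtain ⟨k, rfl⟩ := Nat.exists_eq_add_of_le hst
  have h1 := sum_lsrwLaw_real_pair_le G hd (J * s) (J * k) (A s) (A (s + k))
  rw [← mul_add] at h1
  refine h1.trans ((hM.sum_pow_le k _ _).trans ?_)
  have e : s - (s + k) + (s + k - s) = k := by omega
  rw [e]
  have h2 : (#(A s) : ℝ) * #(A (s + k)) ≤ (m : ℝ) ^ 2 := by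
    rw [sq]
    have := hA s
    have := hA (s + k)
    gcongr
  have h3 : √((#(A s) : ℝ) * #(A (s + k))) ≤ m := Real.sqrt_le_iff.2 ⟨by positivity, h2⟩
  gcongr

/-- Each site of `A` receives total mass 1 from all starting vertices, and at most `#U * (2 / n) ≤ 1
/ 2` of it comes from `U`. -/
theorem Mixes.le_sum_lsrwLaw_real_mem (hM : Mixes G J L) (hd : G.IsRegularOfDegree d)
    {U A : Finset V} (hU : 4 * #U ≤ Fintype.card V) {s : ℕ} (hs : J * L ≤ s) :
    (#A : ℝ) / 2 ≤ ∑ v ∈ Uᶜ, (lsrwLaw G v).real {X | X s ∈ A} := by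
  simp_rw [lsrwLaw_real_mem]
  refine le_trans ?_ sum_comm.le
  rw [div_eq_mul_inv, ← nsmul_eq_mul, ← sum_const]
  refine sum_le_sum fun x _ => ?_
  have h1 := sum_add_sum_compl U fun v => (lsrwMatrix G ^ s) v x
  rw [lsrwMatrix_pow_col_sum G hd] at h1
  have h2 : ∑ v ∈ U, (lsrwMatrix G ^ s) v x ≤ ∑ v ∈ U, 2 / (Fintype.card V : ℝ) :=
    sum_le_sum fun v _ => hM.pow_le s hs v x
  rw [sum_const, nsmul_eq_mul] at h2
  have hn : (0 : ℝ) < Fintype.card V := by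
    have : Nonempty V := ⟨x⟩
    exact_mod_cast Fintype.card_pos
  have h3 : (4 : ℝ) * #U ≤ Fintype.card V := by exact_mod_cast hU
  have h4 : (#U : ℝ) * (2 / (Fintype.card V : ℝ)) ≤ 1 / 2 := by
    rw [← mul_div_assoc, div_le_iff₀ hn]
    linarith
  linarith

/-- The expected number of walkers starting outside `U`, one at each vertex, that hit one of the
space-time sets `A s`. -/
theorem Mixes.min_le_sum_one_sub (hM : Mixes G J L) (hd : G.IsRegularOfDegree d)
    {U : Finset V} (hU0 : U.Nonempty) (hU : 4 * #U ≤ Fintype.card V) (hL : 0 < L)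
    {S : Finset ℕ} (hS : #S = L) (hSL : ∀ s ∈ S, L ≤ s) {A : ℕ → Finset V}
    (hA : ∀ s, #(A s) ≤ #U) (hA' : ∀ s ∈ S, #U ≤ 2 * #(A s)) :
    min ((Fintype.card V : ℝ) / 32) (L * #U / 128)
      ≤ ∑ v ∈ Uᶜ, (1 - (lsrwLaw G v).real {X | ∀ s ∈ S, X (J * s) ∉ A s}) := by
  set m : ℝ := (#U : ℝ) with hm
  set n : ℝ := (Fintype.card V : ℝ) with hn
  have hm0 : 0 < m := by rw [hm]; exact_mod_cast hU0.card_pos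
  have hn0 : 0 < n := by
    have h : (4 : ℝ) * m ≤ n := by rw [hm, hn]; exact_mod_cast hU
    linarith
  have hL0 : (0 : ℝ) < L := by exact_mod_cast hL
  have hfirst : (L : ℝ) * m / 4 ≤
      ∑ s ∈ S, ∑ v ∈ Uᶜ, (lsrwLaw G v).real {X | X (J * s) ∈ A s} := by
    have : ∑ s ∈ S, m / 4 ≤ ∑ s ∈ S, ∑ v ∈ Uᶜ, (lsrwLaw G v).real {X | X (J * s) ∈ A s} := by
      refine sum_le_sum fun s hs => le_trans ?_ (hM.le_sum_lsrwLaw_real_mem G hd hU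
        (Nat.mul_le_mul_left J (hSL s hs)))
      have : m ≤ 2 * #(A s) := by rw [hm]; exact_mod_cast hA' s hs
      linarith
    rw [sum_const, hS, nsmul_eq_mul] at this
    linarith
  have hsecond : ∑ s ∈ S, ∑ t ∈ S, ∑ v,
      (lsrwLaw G v).real ({X | X (J * s) ∈ A s} ∩ {X | X (J * t) ∈ A t})
      ≤ L ^ 2 * m ^ 2 / n + 4 * L * m := by
    have h1 : ∀ s, ∑ t ∈ S, ∑ v,
        (lsrwLaw G v).real ({X | X (J * s) ∈ A s} ∩ {X | X (J * t) ∈ A t})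
        ≤ L * (m ^ 2 / n) + 4 * m := by
      intro s
      refine (sum_le_sum fun t _ => hM.sum_lsrwLaw_real_inter_le G hd hA s t).trans ?_
      rw [sum_add_distrib, sum_const, hS, nsmul_eq_mul, ← sum_mul]
      have := sum_half_pow_dist_le S s
      gcongr
    refine (sum_le_sum fun s _ => h1 s).trans (le_of_eq ?_)
    rw [sum_const, hS, nsmul_eq_mul]
    ring
  -- The bound `1_{N = 0} ≤ (1 - a N) ^ 2` is summed over `v` with the same `a`. The second moment
  -- is enlarged to all `v`, where stationarity applies.
  have hmain : ∀ a : ℝ, 2 * a * ∑ s ∈ S, ∑ v ∈ Uᶜ, (lsrwLaw G v).real {X | X (J * s) ∈ A s}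
      - a ^ 2 * (L ^ 2 * m ^ 2 / n + 4 * L * m)
      ≤ ∑ v ∈ Uᶜ, (1 - (lsrwLaw G v).real {X | ∀ s ∈ S, X (J * s) ∉ A s}) := by
    intro a
    have h1 : ∀ v, 2 * a * ∑ s ∈ S, (lsrwLaw G v).real {X | X (J * s) ∈ A s}
        - a ^ 2 * ∑ s ∈ S, ∑ t ∈ S,
          (lsrwLaw G v).real ({X | X (J * s) ∈ A s} ∩ {X | X (J * t) ∈ A t})
        ≤ 1 - (lsrwLaw G v).real {X | ∀ s ∈ S, X (J * s) ∉ A s} := by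
      intro v
      have := measureReal_forall_notMem_le (lsrwLaw G v) S
        (E := fun s => {X : ℕ → V | X (J * s) ∈ A s})
        (fun s => measurableSet_setOf_apply_mem _ _) a
      simp only [Set.mem_ofPred_eq] at this
      linarith
    have h2 := sum_le_sum fun v (_ : v ∈ Uᶜ) => h1 v
    rw [sum_sub_distrib, ← mul_sum, ← mul_sum, sum_comm] at h2
    refine le_trans (sub_le_sub_left (mul_le_mul_of_nonneg_left (le_trans ?_ hsecond)
      (sq_nonneg a)) _) h2
    calc _ ≤ ∑ v, ∑ s ∈ S, ∑ t ∈ S,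
          (lsrwLaw G v).real ({X | X (J * s) ∈ A s} ∩ {X | X (J * t) ∈ A t}) :=
          sum_le_sum_of_subset_of_nonneg (subset_univ _) fun v _ _ =>
            sum_nonneg fun s _ => sum_nonneg fun t _ => measureReal_nonneg
      _ = _ := by
          rw [sum_comm]
          refine sum_congr rfl fun s _ => ?_
          rw [sum_comm]
  -- The two cases tell which second moment term dominates. In each, `a` is the first moment bound
  -- `L m / 4` divided by twice the dominant term.
  rcases le_total (L * m) (4 * n) with hc | hc
  · refine (min_le_right _ _).trans (le_trans ?_ (hmain (1 / 32)))
    have : (L : ℝ) ^ 2 * m ^ 2 / n ≤ 4 * L * m := by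
      rw [div_le_iff₀ hn0]
      nlinarith [mul_pos hL0 hm0]
    linarith
  · refine (min_le_left _ _).trans (le_trans ?_ (hmain (n / (8 * (L * m)))))
    have hLm : 0 < (L : ℝ) * m := by positivity
    have h1 : 2 * (n / (8 * (L * m))) * (L * m / 4) ≤ 2 * (n / (8 * (L * m))) *
        ∑ s ∈ S, ∑ v ∈ Uᶜ, (lsrwLaw G v).real {X | X (J * s) ∈ A s} := by gcongr
    have h2 : 2 * (n / (8 * (L * m))) * (L * m / 4) = n / 16 := by field_simp; norm_num
    have h3 : (L : ℝ) ^ 2 * m ^ 2 / n + 4 * L * m ≤ 2 * ((L * m) ^ 2 / n) := by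
      have : 4 * L * m ≤ (L * m) ^ 2 / n := by
        rw [le_div_iff₀ hn0]
        nlinarith
      rw [← mul_pow]
      linarith
    have h4 : (n / (8 * (L * m))) ^ 2 * (L ^ 2 * m ^ 2 / n + 4 * L * m)
        ≤ (n / (8 * (L * m))) ^ 2 * (2 * ((L * m) ^ 2 / n)) := by gcongr
    have h5 : (n / (8 * (L * m))) ^ 2 * (2 * ((L * m) ^ 2 / n)) = n / 32 := by
      field_simp; norm_num
    linarith

/-- Independent walkers rarely occupy few sites at many well separated times. -/
theorem Mixes.walkersLaw_real_card_le (hM : Mixes G J L) (U : Finset V) {τ : ℕ → ℕ}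
    (hτ0 : J * L ≤ τ 0) (hτ : ∀ i, τ i + J * L ≤ τ (i + 1)) {k : ℕ} (hk : k ≤ Fintype.card V)
    (B : ℕ) :
    (walkersLaw G).real {ω | ∀ j < B, #(U.image fun u => ω (u, 0) (τ j)) ≤ k}
      ≤ (((Fintype.card V).choose k : ℝ) * (2 * k / Fintype.card V) ^ #U) ^ B := by
  -- Union bound over a choice, at each of the `B` times, of a `k`-set containing all occupied
  -- sites. Each walker is in a given set with conditional probability at most `2k / n`.
  let F : Finset (Fin B → Finset V) := Fintype.piFinset fun _ => powersetCard k univ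
  let S' : (Fin B → Finset V) → ℕ → Finset V := fun S i => if h : i < B then S ⟨i, h⟩ else ∅
  let C : (Fin B → Finset V) → Set (ℕ → V) := fun S => {X | ∀ i < B, X (τ i) ∈ S' S i}
  have hsub : {ω : V × ℕ → ℕ → V | ∀ j < B, #(U.image fun u => ω (u, 0) (τ j)) ≤ k}
      ⊆ ⋃ S ∈ F, {ω | ∀ w ∈ firstWalkers U, ω w ∈ C S} := by
    intro ω hω
    have : ∀ j : Fin B, ∃ S ∈ powersetCard k (univ : Finset V),
        (U.image fun u => ω (u, 0) (τ j)) ⊆ S := by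
      intro j
      obtain ⟨S, hS1, -, hS2⟩ := exists_subsuperset_card_eq
        (subset_univ (U.image fun u => ω (u, 0) (τ j))) (hω j j.2) (by rwa [card_univ])
      exact ⟨S, mem_powersetCard_univ.2 hS2, hS1⟩
    choose S hS1 hS2 using this
    refine Set.mem_biUnion (Fintype.mem_piFinset.2 hS1) ?_
    rintro w hw i hi
    obtain ⟨u, hu, rfl⟩ := mem_image.1 hw
    simp only [S', hi, dite_true]
    exact hS2 ⟨i, hi⟩ (mem_image_of_mem _ hu)
  have hC : ∀ S, MeasurableSet (C S) := by
    intro S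
    have : C S = ⋂ (i : ℕ) (_ : i < B), {X | X (τ i) ∈ S' S i} := by ext; simp [C]
    rw [this]
    exact MeasurableSet.iInter fun i => MeasurableSet.iInter fun _ =>
      measurableSet_setOf_apply_mem _ _
  refine (measureReal_mono hsub (measure_ne_top _ _)).trans ((measureReal_biUnion_finset_le _ _).trans ?_)
  have hterm : ∀ S ∈ F, (walkersLaw G).real {ω | ∀ w ∈ firstWalkers U, ω w ∈ C S}
      ≤ ((2 * k / Fintype.card V : ℝ) ^ B) ^ #U := by
    intro S hS
    rw [walkersLaw, infinitePi_real_forall_mem _ _ fun w _ => hC S]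
    have hcard : #(firstWalkers U) = #U := card_image_of_injective _ fun a b h => by simpa using h
    rw [← hcard, ← prod_const]
    refine prod_le_prod (fun w _ => measureReal_nonneg) fun w _ => ?_
    have := lsrwLaw_real_forall_mem_le G w.1 hτ0 hτ (S := S' S)
      (β := fun _ => 2 * k / Fintype.card V) ?_ B
    · simpa only [prod_const, card_range] using this
    · intro i t ht x
      refine (sum_le_sum fun y _ => hM.pow_le t ht x y).trans ?_
      rw [sum_const, nsmul_eq_mul]
      have : #(S' S i) ≤ k := by
        by_cases hi : i < B
        · simp only [S', hi, dite_true]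
          exact (mem_powersetCard_univ.1 (Fintype.mem_piFinset.1 hS ⟨i, hi⟩)).le
        · simp [S', hi]
      calc (#(S' S i) : ℝ) * (2 / Fintype.card V) ≤ k * (2 / Fintype.card V) := by gcongr
        _ = _ := by ring
  refine (sum_le_sum hterm).trans (le_of_eq ?_)
  rw [sum_const, Fintype.card_piFinset_const, card_powersetCard, card_univ, nsmul_eq_mul, mul_pow,
    Nat.cast_pow, pow_right_comm]

theorem Mixes.lsrwLaw_real_forall_notMem_le (hM : Mixes G J L) (v : V) {τ : ℕ → ℕ}
    (hτ0 : J * L ≤ τ 0) (hτ : ∀ i, τ i + J * L ≤ τ (i + 1)) {A : ℕ → Finset V} {a : ℝ}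
    (N : ℕ) (hA : ∀ i < N, a ≤ #(A i)) :
    (lsrwLaw G v).real {X | ∀ i < N, X (τ i) ∉ A i} ≤ (1 - a / (2 * Fintype.card V)) ^ N := by
  -- Padding by `univ`, because the iterated bound asks for an estimate at every index.
  let A' : ℕ → Finset V := fun i => if i < N then A i else univ
  have hA' : ∀ i, min a (Fintype.card V) ≤ #(A' i) := by
    intro i
    by_cases hi : i < N
    · simpa [A', hi] using Or.inl (hA i hi)
    · simp [A', hi]
  have h := lsrwLaw_real_forall_mem_le G v hτ0 hτ (S := fun i => (A' i)ᶜ)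
    (β := fun _ => 1 - min a (Fintype.card V) / (2 * Fintype.card V)) ?_ N
  · rcases Nat.eq_zero_or_pos N with rfl | hN
    · simp
    have hle : a ≤ Fintype.card V := (hA 0 hN).trans (by exact_mod_cast card_le_univ _)
    rw [min_eq_left hle] at h
    simp only [prod_const, card_range, mem_compl] at h
    refine le_trans (le_of_eq ?_) h
    congr 1
    ext X
    refine forall₂_congr fun i hi => ?_
    simp [A', hi]
  · intro i k hk x
    have h1 := sum_add_sum_compl (A' i) fun y => (lsrwMatrix G ^ k) x y
    rw [lsrwMatrix_pow_row_sum] at h1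
    have h2 : ∑ y ∈ A' i, 1 / (2 * (Fintype.card V : ℝ)) ≤ ∑ y ∈ A' i, (lsrwMatrix G ^ k) x y :=
      sum_le_sum fun y _ => hM.le_pow k hk x y
    rw [sum_const, nsmul_eq_mul] at h2
    have h3 : min a (Fintype.card V) / (2 * (Fintype.card V : ℝ))
        ≤ #(A' i) * (1 / (2 * (Fintype.card V : ℝ))) := by
      rw [mul_one_div]
      have := hA' i
      gcongr
    linarith

end Walk

/-! ### The two bad events: an isolated small set, and two large sets that do not meet. -/

section Events

variable {V : Type*} [Fintype V] [DecidableEq V]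

theorem card_firstWalkers {V : Type*} [DecidableEq V] (U : Finset V) : #(firstWalkers U) = #U :=
  card_image_of_injective _ fun a b h => by simpa using h

/-- The sites occupied at time `s` by walkers with sampled trajectories `g w`, `w ∈ firstWalkers U`. -/
def sites {V : Type*} [DecidableEq V] {H : ℕ} {U : Finset V} (g : firstWalkers U → Fin H → V) (s : ℕ) : Finset V :=
  if h : s < H then univ.image fun w => g w ⟨s, h⟩ else ∅

theorem card_sites_le {V : Type*} [DecidableEq V] {H : ℕ} {U : Finset V} (g : firstWalkers U → Fin H → V) (s : ℕ) :
    #(sites g s) ≤ #U := by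
  unfold sites
  split_ifs
  · refine card_image_le.trans (le_of_eq ?_)
    rw [card_univ, Fintype.card_coe, card_firstWalkers]
  · simp

theorem sites_sample {V : Type*} [DecidableEq V] {H J : ℕ} (U : Finset V) (ω : V × ℕ → ℕ → V) {s : ℕ} (hs : s < H) :
    sites (fun (w : firstWalkers U) (i : Fin H) => ω w (J * i)) s
      = U.image fun u => ω (u, 0) (J * s) := by
  ext x
  simp only [sites, hs, dite_true, mem_image, Subtype.exists, firstWalkers]
  constructor
  · rintro ⟨_, ⟨u, hu, rfl⟩, -, h⟩
    exact ⟨u, hu, h⟩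
  · rintro ⟨u, hu, h⟩
    exact ⟨(u, 0), ⟨u, hu, rfl⟩, mem_univ _, h⟩

variable [MeasurableSpace V] [DiscreteMeasurableSpace V]

theorem measurableSet_forall_notMem_sites {H : ℕ} (J : ℕ) {U : Finset V}
    (g : firstWalkers U → Fin H → V) :
    MeasurableSet {X : ℕ → V | ∀ s < H, X (J * s) ∉ sites g s} := by
  have : {X : ℕ → V | ∀ s < H, X (J * s) ∉ sites g s}
      = ⋂ (s : ℕ) (_ : s < H), {X | X (J * s) ∈ sites g s}ᶜ := by ext; simp
  rw [this]
  exact MeasurableSet.iInter fun s => MeasurableSet.iInter fun _ =>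
    (measurableSet_setOf_apply_mem _ _).compl

variable (G : SimpleGraph V) [DecidableRel G.Adj] {d J L : ℕ}

/-- The event that the first walkers from `U` meet no walker from outside `U` is unlikely. -/
theorem Mixes.snLaw_real_isolated_le (hM : Mixes G J L) (hd : G.IsRegularOfDegree d) (hd0 : d ≠ 0)
    {U : Finset V} (hU0 : U.Nonempty) (hU : 4 * #U ≤ Fintype.card V) (hL : 0 < L) (B : ℕ) :
    (snLaw G).real {ω | ∀ v ∉ U, ∀ i < ω.1 v, ∀ s < L * (B + 1), ∀ u ∈ U,
        ω.2 (v, i) (J * s) ≠ ω.2 (u, 0) (J * s)}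
      ≤ L * (((Fintype.card V).choose (#U / 2) : ℝ)
          * (2 * (#U / 2 : ℕ) / Fintype.card V) ^ #U) ^ B
        + Real.exp (-min ((Fintype.card V : ℝ) / 32) (L * #U / 128)) := by
  set H := L * (B + 1) with hH
  -- Sampling finitely many times gives a finite-valued statistic to condition on.
  let f : (ℕ → V) → Fin H → V := fun X i => X (J * i)
  have hf : Measurable f := by fun_prop
  let R : (firstWalkers U → Fin H → V) → Set (ℕ → V) :=
    fun g => {X | ∀ s < H, X (J * s) ∉ sites g s}
  have hR : ∀ g, MeasurableSet (R g) := fun g => measurableSet_forall_notMem_sites J g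
  have hev : {ω : Config V | ∀ v ∉ U, ∀ i < ω.1 v, ∀ s < H, ∀ u ∈ U,
        ω.2 (v, i) (J * s) ≠ ω.2 (u, 0) (J * s)}
      = {ω | ∀ v ∉ U, ∀ i < ω.1 v, ω.2 (v, i) ∈ R (fun w => f (ω.2 w))} := by
    ext ω
    refine forall₄_congr fun v _ i _ => forall₂_congr fun s hs => ?_
    rw [sites_sample U ω.2 hs]
    simp [eq_comm]
  rw [hev, snLaw_real_forall_mem_eq_sum G hd hd0 U hf hR]
  have hsum0 : ∀ g, ∀ v ∈ Uᶜ, 0 ≤ 1 - (lsrwLaw G v).real (R g) := fun g v _ =>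
    sub_nonneg.2 measureReal_le_one
  refine (sum_walkersLaw_real_mul_le G U hf
    -- Times are grouped by residue modulo `L`, so that those in one class are `J * L` apart in real
    -- time and few sites at all `B` of them is unlikely. The shift `j + 1` lets the walk mix before
    -- the first one.
    (bad := fun g => ∃ r < L, ∀ j < B, #(sites g (L * (j + 1) + r)) ≤ #U / 2)
    (Real.exp_pos _).le (fun g => ?_) fun g hg => ?_).trans (add_le_add ?_ le_rfl)
  · rw [Real.exp_le_one_iff, neg_nonpos]
    exact sum_nonneg (hsum0 g)
  · push Not at hg
    choose! j hjB hj using hg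
    -- One time with many sites from each residue class: `L` distinct times.
    let S : Finset ℕ := (range L).image fun r => L * (j r + 1) + r
    have hinj : Set.InjOn (fun r => L * (j r + 1) + r) (range L : Set ℕ) := by
      intro r hr r' hr' h
      simp only [coe_range, Set.mem_Iio] at hr hr'
      have := congrArg (· % L) h
      simpa [Nat.mul_add_mod, Nat.mod_eq_of_lt hr, Nat.mod_eq_of_lt hr'] using this
    have hmin := hM.min_le_sum_one_sub G hd hU0 hU hL (S := S)
      (by rw [card_image_of_injOn hinj, card_range]) ?_ (card_sites_le g) ?_
    · refine Real.exp_le_exp.2 (neg_le_neg (hmin.trans (sum_le_sum fun v _ => ?_)))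
      suffices hsub : R g ⊆ {X | ∀ s ∈ S, X (J * s) ∉ sites g s} from
        sub_le_sub_left (measureReal_mono hsub (measure_ne_top _ _)) _
      intro X hX s hs
      refine hX s ?_
      obtain ⟨r, hr, rfl⟩ := mem_image.1 hs
      have h1 := mem_range.1 hr
      have h2 : L * (j r + 1) ≤ L * B := Nat.mul_le_mul_left L (hjB r h1)
      rw [hH, mul_add L B 1]
      omega
    · intro s hs
      obtain ⟨r, hr, rfl⟩ := mem_image.1 hs
      rw [mul_add]
      omega
    · intro s hs
      obtain ⟨r, hr, rfl⟩ := mem_image.1 hs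
      have := hj r (mem_range.1 hr)
      omega
  · have hsub : {ω : V × ℕ → ℕ → V | ∃ r < L, ∀ j < B,
          #(sites (fun w : firstWalkers U => f (ω w)) (L * (j + 1) + r)) ≤ #U / 2}
        ⊆ ⋃ r ∈ range L, {ω | ∀ j < B,
          #(U.image fun u => ω (u, 0) (J * (L * (j + 1) + r))) ≤ #U / 2} := by
      rintro ω ⟨r, hr, h⟩
      refine Set.mem_biUnion (mem_range.2 hr) fun j hj => ?_
      rw [← sites_sample (H := H) U ω]
      · exact h j hj
      · have h2 : L * (j + 1) ≤ L * B := Nat.mul_le_mul_left L hj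
        rw [hH, mul_add L B 1]
        omega
    refine (measureReal_mono hsub (measure_ne_top _ _)).trans
      ((measureReal_biUnion_finset_le _ _).trans ?_)
    refine (sum_le_card_nsmul _ _ ((((Fintype.card V).choose (#U / 2) : ℝ)
      * (2 * (#U / 2 : ℕ) / Fintype.card V) ^ #U) ^ B) fun r _ => ?_).trans (le_of_eq ?_)
    · refine hM.walkersLaw_real_card_le G U (τ := fun j => J * (L * (j + 1) + r)) ?_ (fun i => ?_)
        ?_ B
      · exact Nat.mul_le_mul_left J (by omega)
      · rw [← mul_add]
        exact Nat.mul_le_mul_left J (by rw [mul_add L (i + 1) 1]; omega)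
      · omega
    · rw [card_range, nsmul_eq_mul]

/-- The event that the first walkers from `U` do not meet the first walkers from `U'` is unlikely. -/
theorem Mixes.walkersLaw_real_no_meeting_le (hM : Mixes G J L) {U U' : Finset V}
    (hUU : Disjoint U U') (N : ℕ) {B : ℕ} (hB : 0 < B) :
    (walkersLaw G).real {ω | ∀ s < L * (N * B) + 1, ∀ u ∈ U, ∀ u' ∈ U',
        ω (u', 0) (J * s) ≠ ω (u, 0) (J * s)}
      ≤ N * (((Fintype.card V).choose (#U / 2) : ℝ)
          * (2 * (#U / 2 : ℕ) / Fintype.card V) ^ #U) ^ B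
        + ((1 - (#U / 2 : ℝ) / (2 * Fintype.card V)) ^ N) ^ #U' := by
  set H := L * (N * B) + 1 with hH
  let f : (ℕ → V) → Fin H → V := fun X i => X (J * i)
  have hf : Measurable f := by fun_prop
  let R : (firstWalkers U → Fin H → V) → Set (ℕ → V) :=
    fun g => {X | ∀ s < H, X (J * s) ∉ sites g s}
  have hR : ∀ g, MeasurableSet (R g) := fun g => measurableSet_forall_notMem_sites J g
  have hD : Disjoint (firstWalkers U) (firstWalkers U') :=
    (disjoint_image fun a b h => by simpa using h).2 hUU
  have hev : {ω : V × ℕ → ℕ → V | ∀ s < H, ∀ u ∈ U, ∀ u' ∈ U',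
        ω (u', 0) (J * s) ≠ ω (u, 0) (J * s)}
      = {ω | ∀ w ∈ firstWalkers U', ω w ∈ R (fun w => f (ω w))} := by
    ext ω
    have h1 : ∀ w s, s < H → (ω w (J * s) ∉ sites (fun w : firstWalkers U => f (ω w)) s
        ↔ ∀ u ∈ U, ω w (J * s) ≠ ω (u, 0) (J * s)) := by
      intro w s hs
      rw [sites_sample U ω hs]
      simp [eq_comm]
    constructor
    · rintro h w hw s hs
      obtain ⟨u', hu', rfl⟩ := mem_image.1 hw
      exact (h1 _ s hs).2 fun u hu => h s hs u hu u' hu'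
    · intro h s hs u hu u' hu'
      exact (h1 _ s hs).1 (h (u', 0) (mem_image_of_mem _ hu') s hs) u hu
  have hn : (0 : ℝ) ≤ Fintype.card V := Nat.cast_nonneg _
  have hUn : (#U : ℝ) ≤ Fintype.card V := by exact_mod_cast card_le_univ U
  have h01 : 0 ≤ 1 - (#U / 2 : ℝ) / (2 * Fintype.card V) := by
    rw [sub_nonneg]
    exact div_le_one_of_le₀ (by linarith) (by positivity)
  have key := infinitePi_real_forall_mem_eq_sum (fun w : V × ℕ => lsrwLaw G w.1) hD hf
    (R := fun g _ => R g) (fun g _ => hR g)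
  rw [hev]
  refine (le_of_eq key).trans ?_
  refine (sum_walkersLaw_real_mul_le G U hf
    -- `N` consecutive blocks of `B` times. Off the bad event each block has a time with many sites,
    -- and the chosen times are at least `L` apart, so every walker from `U'` has `N` fresh chances
    -- to hit.
    (bad := fun g => ∃ r < N, ∀ j < B, #(sites g (L * (r * B + j + 1))) ≤ #U / 2)
    (κ := ((1 - (#U / 2 : ℝ) / (2 * Fintype.card V)) ^ N) ^ #U')
    (by positivity) (fun g => ?_) fun g hg => ?_).trans (add_le_add ?_ le_rfl)
  · exact prod_le_one (fun w _ => measureReal_nonneg) fun w _ => measureReal_le_one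
  · push Not at hg
    choose! j hjB hj using hg
    have hmem : ∀ r < N, L * (r * B + j r + 1) < H := by
      intro r hr
      have h1 : (r + 1) * B ≤ N * B := Nat.mul_le_mul_right B hr
      have h2 : r * B + j r + 1 ≤ N * B := by
        have := hjB r hr
        rw [add_mul] at h1
        omega
      have := Nat.mul_le_mul_left L h2
      omega
    rw [← card_firstWalkers U', ← prod_const]
    refine prod_le_prod (fun w _ => measureReal_nonneg) fun w _ => ?_
    -- The spacing condition is required for all `r`, so `j` needs a value below `B` beyond `N` too.
    let j' : ℕ → ℕ := fun r => if r < N then j r else 0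
    have hj' : ∀ r < N, j' r = j r := fun r hr => by simp [j', hr]
    have hj'B : ∀ r, j' r < B := by
      intro r
      by_cases hr : r < N
      · rw [hj' r hr]
        exact hjB r hr
      · simpa [j', hr] using hB
    have := hM.lsrwLaw_real_forall_notMem_le G w.1
      (τ := fun r => J * (L * (r * B + j' r + 1)))
      (A := fun r => sites g (L * (r * B + j' r + 1))) (a := (#U / 2 : ℝ)) ?_ ?_ N ?_
    · refine le_trans (measureReal_mono ?_ (measure_ne_top _ _)) this
      intro X hX r hr
      refine hX _ ?_
      rw [hj' r hr]
      exact hmem r hr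
    · refine Nat.mul_le_mul_left J ?_
      exact Nat.le_mul_of_pos_right L (by omega)
    · intro r
      rw [← mul_add]
      refine Nat.mul_le_mul_left J ?_
      rw [← Nat.mul_succ]
      refine Nat.mul_le_mul_left L ?_
      rw [add_mul]
      have := hj'B r
      omega
    · intro r hr
      have h1 := hj r hr
      rw [hj' r hr]
      have h2 : #U ≤ 2 * #(sites g (L * (r * B + j r + 1))) := by omega
      have h3 : (#U : ℝ) ≤ 2 * #(sites g (L * (r * B + j r + 1))) := by exact_mod_cast h2
      linarith
  · have hsub : {ω : V × ℕ → ℕ → V | ∃ r < N, ∀ j < B,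
          #(sites (fun w : firstWalkers U => f (ω w)) (L * (r * B + j + 1))) ≤ #U / 2}
        ⊆ ⋃ r ∈ range N, {ω | ∀ j < B,
          #(U.image fun u => ω (u, 0) (J * (L * (r * B + j + 1)))) ≤ #U / 2} := by
      rintro ω ⟨r, hr, h⟩
      refine Set.mem_biUnion (mem_range.2 hr) fun j hj => ?_
      rw [← sites_sample (H := H) U ω]
      · exact h j hj
      · have h1 : (r + 1) * B ≤ N * B := Nat.mul_le_mul_right B hr
        have h2 : r * B + j + 1 ≤ N * B := by
          rw [add_mul] at h1
          omega
        have := Nat.mul_le_mul_left L h2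
        omega
    refine (measureReal_mono hsub (measure_ne_top _ _)).trans
      ((measureReal_biUnion_finset_le _ _).trans ?_)
    refine (sum_le_card_nsmul _ _ ((((Fintype.card V).choose (#U / 2) : ℝ)
      * (2 * (#U / 2 : ℕ) / Fintype.card V) ^ #U) ^ B) fun r _ => ?_).trans (le_of_eq ?_)
    · refine hM.walkersLaw_real_card_le G U (τ := fun j => J * (L * (r * B + j + 1))) ?_
        (fun i => ?_) ?_ B
      · exact Nat.mul_le_mul_left J (Nat.le_mul_of_pos_right L (by omega))
      · rw [← mul_add]
        exact Nat.mul_le_mul_left J (by rw [← Nat.mul_succ]; exact Nat.mul_le_mul_left L (by omega))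
      · exact (Nat.div_le_self _ _).trans (card_le_univ U)
    · rw [card_range, nsmul_eq_mul]

end Events

/-! ### Numerical estimates for the union bounds. -/

section Estimates

theorem choose_mul_pow_self_le (n k : ℕ) : (n.choose k : ℝ) * (k : ℝ) ^ k ≤ (3 * n) ^ k := by
  have h1 : (k : ℝ) ^ k ≤ 3 ^ k * k.factorial := by
    have h := Real.pow_div_factorial_le_exp (k : ℝ) (Nat.cast_nonneg k) k
    rw [div_le_iff₀ (by positivity)] at h
    refine h.trans (mul_le_mul_of_nonneg_right ?_ (by positivity))
    rw [← Real.exp_one_pow]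
    exact pow_le_pow_left₀ (Real.exp_pos 1).le Real.exp_one_lt_three.le k
  have h2 : (n.choose k : ℝ) * k.factorial ≤ n ^ k := by
    have := Nat.choose_le_pow_div (α := ℝ) k n
    rwa [le_div_iff₀ (by positivity)] at this
  calc (n.choose k : ℝ) * (k : ℝ) ^ k ≤ n.choose k * (3 ^ k * k.factorial) := by gcongr
    _ = 3 ^ k * (n.choose k * k.factorial) := by ring
    _ ≤ 3 ^ k * n ^ k := by gcongr
    _ = _ := by rw [mul_pow]

/-- With `k = m / 2`, the first `k` of the `m` factors `2k / n` cancel the binomial coefficient up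
to `6 ^ k`; the other `m - k` remain. -/
theorem choose_half_mul_pow_le {n : ℕ} (hn : 0 < n) (m : ℕ) :
    (n.choose (m / 2) : ℝ) * (2 * (m / 2 : ℕ) / n) ^ m ≤ (6 * m / n) ^ (m - m / 2) := by
  set k := m / 2 with hk
  have hn' : (0 : ℝ) < n := by exact_mod_cast hn
  have hkm : (2 : ℝ) * k ≤ m := by
    have : 2 * k ≤ m := by omega
    exact_mod_cast this
  have h1 : (n.choose k : ℝ) * (2 * k / n) ^ k ≤ 6 ^ k := by
    have := choose_mul_pow_self_le n k
    rw [div_pow, mul_pow, ← mul_div_assoc, div_le_iff₀ (by positivity)]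
    calc (n.choose k : ℝ) * (2 ^ k * k ^ k) = 2 ^ k * (n.choose k * k ^ k) := by ring
      _ ≤ 2 ^ k * (3 * n) ^ k := by gcongr
      _ = 6 ^ k * n ^ k := by rw [← mul_pow, ← mul_pow]; congr 1; ring
  have e : m = k + (m - k) := by omega
  calc (n.choose k : ℝ) * (2 * k / n) ^ m
      = (n.choose k : ℝ) * (2 * k / n) ^ k * (2 * k / n) ^ (m - k) := by
        rw [mul_assoc, ← pow_add, ← e]
    _ ≤ 6 ^ k * (m / n) ^ (m - k) := by gcongr
    _ ≤ 6 ^ (m - k) * (m / n) ^ (m - k) := by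
        gcongr
        · norm_num
        · omega
    _ = _ := by rw [← mul_pow, mul_div_assoc]

variable {n m : ℕ}

theorem div_pow_self_le (hm : 1 ≤ m) (hmn : 30000 * m ≤ n) :
    ((m : ℝ) / n) ^ m ≤ 1 / n ∧ ((m : ℝ) / n) ^ m ≤ (1 / 2) ^ m := by
  have hm' : (1 : ℝ) ≤ m := by exact_mod_cast hm
  have hmn' : (30000 : ℝ) * m ≤ n := by exact_mod_cast hmn
  have hn : (0 : ℝ) < n := by linarith
  have hx : (m : ℝ) / n ≤ 1 / 2 := by
    rw [div_le_div_iff₀ hn (by norm_num)]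
    linarith
  refine ⟨?_, pow_le_pow_left₀ (by positivity) hx m⟩
  obtain ⟨j, rfl⟩ : ∃ j, m = j + 1 := ⟨m - 1, by omega⟩
  have h2 : ((j + 1 : ℕ) : ℝ) ≤ 2 ^ j := by
    have : j + 1 ≤ 2 ^ j := Nat.lt_two_pow_self
    exact_mod_cast this
  calc (((j + 1 : ℕ) : ℝ) / n) ^ (j + 1)
      = (((j + 1 : ℕ) : ℝ) / n) ^ j * (((j + 1 : ℕ) : ℝ) / n) := pow_succ _ _
    _ ≤ (1 / 2) ^ j * (2 ^ j / n) := by gcongr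
    _ = 1 / n := by rw [one_div, inv_pow]; field_simp

theorem choose_mul_few_sites_le (hm : 1 ≤ m) (hmn : 30000 * m ≤ n) :
    (n.choose m : ℝ) * ((n.choose (m / 2) : ℝ) * (2 * (m / 2 : ℕ) / n) ^ m) ^ 10
      ≤ 1 / n ^ 2 * (1 / 2) ^ m := by
  have hm' : (1 : ℝ) ≤ m := by exact_mod_cast hm
  have hmn' : (30000 : ℝ) * m ≤ n := by exact_mod_cast hmn
  have hn : (0 : ℝ) < n := by linarith
  obtain ⟨hx1, hx2⟩ := div_pow_self_le hm hmn
  have hx : 30000 * ((m : ℝ) / n) ≤ 1 := by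
    rw [← mul_div_assoc, div_le_one hn]
    exact hmn'
  have h1 := choose_half_mul_pow_le (by omega : 0 < n) m
  rw [mul_div_assoc (6 : ℝ)] at h1
  have h3 : (n.choose m : ℝ) * ((m : ℝ) / n) ^ m ≤ 3 ^ m := by
    have := choose_mul_pow_self_le n m
    rw [div_pow, ← mul_div_assoc, div_le_iff₀ (by positivity), ← mul_pow]
    exact this
  set x : ℝ := (m : ℝ) / n with hxdef
  have hx0 : 0 ≤ x := by positivity
  have h2 : ((n.choose (m / 2) : ℝ) * (2 * (m / 2 : ℕ) / n) ^ m) ^ 10 ≤ (6 * x) ^ (5 * m) := by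
    calc _ ≤ ((6 * x) ^ (m - m / 2)) ^ 10 := by gcongr
      _ = (6 * x) ^ ((m - m / 2) * 10) := by rw [← pow_mul]
      _ ≤ _ := pow_le_pow_of_le_one (by positivity) (by linarith) (by omega)
  calc _ ≤ (n.choose m : ℝ) * (6 * x) ^ (5 * m) := by gcongr
    _ = ((n.choose m : ℝ) * x ^ m) * (6 ^ 5 * x ^ 4) ^ m := by
        rw [pow_mul, mul_assoc, ← mul_pow]
        congr 2
        ring
    _ ≤ 3 ^ m * (6 ^ 5 * x ^ 4) ^ m := by gcongr
    -- Here `23328 = 3 * 6 ^ 5`. One factor `x ≤ 1 / 30000` absorbs it, which is why sets count as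
    -- small up to `n / 30000`. Of the other three powers of `x ^ m`, two give `1 / n ^ 2` and one
    -- gives `(1 / 2) ^ m`.
    _ = (23328 * x * x ^ 3) ^ m := by
        rw [← mul_pow]
        congr 1
        ring
    _ ≤ (1 * x ^ 3) ^ m := by
        gcongr
        linarith
    _ = (x ^ m) ^ 2 * x ^ m := by ring
    _ ≤ (1 / n) ^ 2 * (1 / 2) ^ m := by gcongr
    _ = _ := by rw [_root_.one_div_pow]

/-- Half of the exponent pays for `128 ^ m`, the other half for `(n / 128) ^ m / m!`. It must stay
below the `n / 32` of `Mixes.min_le_sum_one_sub`. -/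
theorem choose_le_exp (hmn : 30000 * m ≤ n) : (n.choose m : ℝ) ≤ Real.exp (n / 64) := by
  have hmn' : (30000 : ℝ) * m ≤ n := by exact_mod_cast hmn
  have h1 := Nat.choose_le_pow_div (α := ℝ) m n
  have h2 := Real.pow_div_factorial_le_exp ((n : ℝ) / 128) (by positivity) m
  have h3 : (128 : ℝ) ^ m ≤ Real.exp (n / 128) := by
    have e : (128 : ℝ) ≤ Real.exp 7 := by
      rw [show (7 : ℝ) = (7 : ℕ) by norm_num, ← Real.exp_one_pow]
      have : (2 : ℝ) ≤ Real.exp 1 := by linarith [Real.add_one_le_exp 1]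
      calc (128 : ℝ) = 2 ^ 7 := by norm_num
        _ ≤ _ := by gcongr
    calc (128 : ℝ) ^ m ≤ Real.exp 7 ^ m := by gcongr
      _ = Real.exp (m * 7) := by rw [← Real.exp_nat_mul]
      _ ≤ _ := Real.exp_le_exp.2 (by linarith)
  calc (n.choose m : ℝ) ≤ n ^ m / m.factorial := h1
    _ = 128 ^ m * ((n / 128) ^ m / m.factorial) := by rw [div_pow]; field_simp
    _ ≤ Real.exp (n / 128) * Real.exp (n / 128) := by gcongr
    _ = _ := by rw [← Real.exp_add]; congr 1; ring

/-- As `512 = 4 * 128`, the exponential is at most `n ^ (-4m)`; one `n ^ m` pays for the choice of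
the set. -/
theorem choose_mul_exp_le (hm : 1 ≤ m) (hmn : 30000 * m ≤ n) {L : ℕ}
    (hL : 512 * Real.log n ≤ L) :
    (n.choose m : ℝ) * Real.exp (-(L * m / 128)) ≤ 1 / n ^ 2 * (1 / 2) ^ m := by
  have hm' : (1 : ℝ) ≤ m := by exact_mod_cast hm
  have hmn' : (30000 : ℝ) * m ≤ n := by exact_mod_cast hmn
  have hn : (0 : ℝ) < n := by linarith
  have h1 : (n.choose m : ℝ) ≤ n ^ m := by exact_mod_cast Nat.choose_le_pow n m
  have h2 : Real.exp (-(L * m / 128)) ≤ ((n : ℝ)⁻¹) ^ (4 * m) := by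
    calc Real.exp (-(L * m / 128)) ≤ Real.exp ((4 * m : ℕ) * -Real.log n) := by
          refine Real.exp_le_exp.2 ?_
          push_cast
          nlinarith
      _ = _ := by rw [Real.exp_nat_mul, Real.exp_neg, Real.exp_log hn]
  have h3 : (n : ℝ)⁻¹ ≤ 1 / 2 := by
    rw [inv_le_comm₀ hn (by norm_num)]
    linarith
  calc _ ≤ (n : ℝ) ^ m * ((n : ℝ)⁻¹) ^ (4 * m) := by gcongr
    _ = ((n : ℝ)⁻¹) ^ (2 * m) * ((n : ℝ)⁻¹) ^ m := by
        rw [← pow_add, show 4 * m = m + (2 * m + m) by ring, pow_add _ m, ← mul_assoc, ← mul_pow,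
          mul_inv_cancel₀ hn.ne', one_pow, one_mul]
    _ ≤ ((n : ℝ)⁻¹) ^ 2 * (1 / 2) ^ m := by
        gcongr ?_ * ?_
        · exact pow_le_pow_of_le_one (by positivity) (by linarith) (by omega)
        · gcongr
    _ = _ := by rw [inv_pow, one_div (_ ^ 2 : ℝ)]

/-- The base is at most `1 / 3`, hence below `exp (-1)`, and `(m / 2) * 480000 = 4 * (60000 m) ≥
4n`. -/
theorem few_sites_le_exp (hmn : 30000 * m ≤ n) (hnm : n ≤ 60000 * m) (hn : 0 < n) {B : ℕ} (hB : 480000 ≤ B) :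
    ((n.choose (m / 2) : ℝ) * (2 * (m / 2 : ℕ) / n) ^ m) ^ B ≤ Real.exp (-(4 * n)) := by
  have hmn' : (30000 : ℝ) * m ≤ n := by exact_mod_cast hmn
  have hn' : (0 : ℝ) < n := by exact_mod_cast hn
  have hx : 6 * (m : ℝ) / n ≤ Real.exp (-1) := by
    have : (1 : ℝ) / 3 ≤ Real.exp (-1) := by
      rw [Real.exp_neg, one_div]
      exact inv_anti₀ (Real.exp_pos 1) Real.exp_one_lt_three.le
    refine le_trans ?_ this
    rw [div_le_div_iff₀ hn' (by norm_num)]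
    linarith
  calc _ ≤ ((6 * m / n : ℝ) ^ (m - m / 2)) ^ B := by
        gcongr
        exact choose_half_mul_pow_le hn m
    _ ≤ (Real.exp (-1) ^ (m - m / 2)) ^ B := by gcongr
    _ = Real.exp (-1) ^ ((m - m / 2) * B) := by rw [← pow_mul]
    _ ≤ Real.exp (-1) ^ (4 * n) :=
        pow_le_pow_of_le_one (Real.exp_pos _).le (Real.exp_le_one_iff.2 (by norm_num)) (by
          have := Nat.mul_le_mul_left (m - m / 2) hB
          omega)
    _ = _ := by
        rw [← Real.exp_nat_mul]
        push_cast
        congr 1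
        ring

/-- The exponent is `N m² / (4n)`, so `N ≥ 16 * 60000 ^ 2 = 57600000000` suffices. -/
theorem avoid_le_exp (hmn : m ≤ n) (hnm : n ≤ 60000 * m) (hn : 0 < n) {N : ℕ}
    (hN : 57600000000 ≤ N) :
    ((1 - (m / 2 : ℝ) / (2 * n)) ^ N) ^ m ≤ Real.exp (-(4 * n)) := by
  have hmn' : (m : ℝ) ≤ n := by exact_mod_cast hmn
  have hnm' : (n : ℝ) ≤ 60000 * m := by exact_mod_cast hnm
  have hn' : (0 : ℝ) < n := by exact_mod_cast hn
  have h0 : 0 ≤ 1 - (m / 2 : ℝ) / (2 * n) := by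
    rw [sub_nonneg]
    exact div_le_one_of_le₀ (by linarith) (by positivity)
  calc _ = (1 - (m / 2 : ℝ) / (2 * n)) ^ (N * m) := by rw [← pow_mul]
    _ ≤ Real.exp (-((m / 2 : ℝ) / (2 * n))) ^ (N * m) :=
        pow_le_pow_left₀ h0 (Real.one_sub_le_exp_neg _) _
    _ = Real.exp (((N * m : ℕ) : ℝ) * -((m / 2 : ℝ) / (2 * n))) := by
        rw [← Real.exp_nat_mul]
    _ ≤ _ := by
        refine Real.exp_le_exp.2 ?_
        rw [mul_neg, neg_le_neg_iff, ← mul_div_assoc, le_div_iff₀ (by positivity)]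
        have hN' : (57600000000 : ℝ) ≤ N := by exact_mod_cast hN
        push_cast
        calc (4 : ℝ) * n * (2 * n) ≤ 57600000000 * m * (m / 2) := by nlinarith
          _ ≤ N * m * (m / 2) := by gcongr

theorem sum_half_pow_le_two (S : Finset ℕ) : ∑ i ∈ S, (1 / 2 : ℝ) ^ i ≤ 2 :=
  (summable_geometric_two.sum_le_tsum S fun i _ => by positivity).trans_eq tsum_geometric_two

theorem exp_neg_min_le (a b : ℝ) : Real.exp (-min a b) ≤ Real.exp (-a) + Real.exp (-b) := by
  rcases min_choice a b with h | h <;> rw [h]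
  · linarith [Real.exp_pos (-b)]
  · linarith [Real.exp_pos (-a)]

/-- The union bound over small sets of starting vertices. -/
theorem sum_choose_mul_le {L : ℕ} (hL : 512 * Real.log n ≤ L) :
    ∑ m ∈ Icc 1 (n / 30000), (n.choose m : ℝ) *
      (L * ((n.choose (m / 2) : ℝ) * (2 * (m / 2 : ℕ) / n) ^ m) ^ 10
        + Real.exp (-min ((n : ℝ) / 32) (L * m / 128)))
      ≤ 2 * (L + 1) / n ^ 2 + n * Real.exp (-(n / 64)) := by
  have h1 : ∀ m ∈ Icc 1 (n / 30000), (n.choose m : ℝ) *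
      (L * ((n.choose (m / 2) : ℝ) * (2 * (m / 2 : ℕ) / n) ^ m) ^ 10
        + Real.exp (-min ((n : ℝ) / 32) (L * m / 128)))
      ≤ (L + 1) / n ^ 2 * (1 / 2) ^ m + Real.exp (-(n / 64)) := by
    intro m hm
    rw [mem_Icc] at hm
    have hmn : 30000 * m ≤ n := by omega
    have ha := choose_mul_few_sites_le hm.1 hmn
    have hb := choose_mul_exp_le hm.1 hmn hL
    have hc : (n.choose m : ℝ) * Real.exp (-((n : ℝ) / 32)) ≤ Real.exp (-(n / 64)) := by
      calc _ ≤ Real.exp (n / 64) * Real.exp (-((n : ℝ) / 32)) := by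
            gcongr
            exact choose_le_exp hmn
        _ = _ := by rw [← Real.exp_add]; congr 1; ring
    have hd := mul_le_mul_of_nonneg_left (exp_neg_min_le ((n : ℝ) / 32) (L * m / 128))
      (Nat.cast_nonneg (α := ℝ) (n.choose m))
    have he := mul_le_mul_of_nonneg_left ha (Nat.cast_nonneg (α := ℝ) L)
    calc _ = (L : ℝ) * ((n.choose m : ℝ) *
            ((n.choose (m / 2) : ℝ) * (2 * (m / 2 : ℕ) / n) ^ m) ^ 10)
          + n.choose m * Real.exp (-min ((n : ℝ) / 32) (L * m / 128)) := by ring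
      _ ≤ (L : ℝ) * (1 / n ^ 2 * (1 / 2) ^ m)
          + (Real.exp (-(n / 64)) + 1 / n ^ 2 * (1 / 2) ^ m) := by linarith
      _ = _ := by ring
  refine (sum_le_sum h1).trans ?_
  rw [sum_add_distrib, ← mul_sum, sum_const, Nat.card_Icc, nsmul_eq_mul]
  have h2 : ((n / 30000 + 1 - 1 : ℕ) : ℝ) ≤ n := by
    have : n / 30000 + 1 - 1 ≤ n := by omega
    exact_mod_cast this
  have h3 := sum_half_pow_le_two (Icc 1 (n / 30000))
  calc _ ≤ (L + 1 : ℝ) / n ^ 2 * 2 + n * Real.exp (-(n / 64)) := by gcongr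
    _ = _ := by ring

theorem total_error_le (hn : 2 ≤ n) {L : ℕ} (hL : (L : ℝ) ≤ 512 * Real.log n + 1) :
    2 * (L + 1) / n ^ 2 + n * Real.exp (-((n : ℝ) / 64))
      + Real.exp (2 * n) * ((57600000000 + 1) * Real.exp (-(4 * n)))
      ≤ (57600009217 : ℝ) / n := by
  have hn' : (2 : ℝ) ≤ n := by exact_mod_cast hn
  have hn0 : (0 : ℝ) < n := by linarith
  have h1 : 2 * ((L : ℝ) + 1) / n ^ 2 ≤ 1024 / n := by
    have := Real.log_le_sub_one_of_pos hn0
    rw [div_le_div_iff₀ (by positivity) hn0]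
    nlinarith
  have h2 : (n : ℝ) * Real.exp (-((n : ℝ) / 64)) ≤ 8192 / n := by
    have := Real.pow_div_factorial_le_exp ((n : ℝ) / 64) (by positivity) 2
    rw [Real.exp_neg, ← div_eq_mul_inv, div_le_div_iff₀ (Real.exp_pos _) hn0]
    norm_num [Nat.factorial] at this
    nlinarith
  have h3 : Real.exp (2 * n) * ((57600000000 + 1) * Real.exp (-(4 * n)))
      ≤ (57600000000 + 1 : ℝ) / n := by
    have e : Real.exp (2 * n) * ((57600000000 + 1) * Real.exp (-(4 * (n : ℝ))))
        = (57600000000 + 1) * Real.exp (-(2 * n)) := by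
      rw [mul_left_comm, ← Real.exp_add]
      congr 2
      ring
    rw [e, Real.exp_neg, ← div_eq_mul_inv]
    have := Real.add_one_le_exp (2 * (n : ℝ))
    gcongr
    linarith
  calc _ ≤ (1024 : ℝ) / n + 8192 / n + (57600000000 + 1) / n := by linarith
    _ = _ := by ring

end Estimates

/-! ### Reduction to the two bad events and the final union bound. -/

section Acquaintance

variable {V : Type*} [Fintype V] [DecidableEq V]

theorem MetBy.symm {V : Type*} {ω : Config V} {t : ℕ} {a b : Walker ω} (h : MetBy ω t a b) : MetBy ω t b a := by
  obtain ⟨s, hs, h⟩ := h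
  exact ⟨s, hs, h.symm⟩

/-- If not all walkers are acquainted by time `t`, then either there is a small nonempty set of
vertices whose first walkers meet no walker from elsewhere, or there are two large disjoint sets of
vertices whose first walkers do not meet. -/
theorem exists_isolated_or_no_meeting {V : Type*} [Fintype V] {ω : Config V} (h0 : ∀ w, ω.2 w 0 = w.1) {t : ℕ}
    {a b : Walker ω} (hab : ¬ AcquaintedBy ω t a b) (m : ℕ) :
    (∃ U : Finset V, U.Nonempty ∧ #U ≤ m ∧
      ∀ v ∉ U, ∀ i < ω.1 v, ∀ s ≤ t, ∀ u ∈ U, ω.2 (v, i) s ≠ ω.2 (u, 0) s) ∨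
    (∃ U U' : Finset V, Disjoint U U' ∧ #U = m ∧ #U' = m ∧
      ∀ s ≤ t, ∀ u ∈ U, ∀ u' ∈ U', ω.2 (u', 0) s ≠ ω.2 (u, 0) s) := by
  classical
  let acq : V × ℕ → Prop := fun w => ∃ h : w.2 < ω.1 w.1, AcquaintedBy ω t a ⟨w, h⟩
  have hstep : ∀ w w' : V × ℕ, w.2 < ω.1 w.1 → w'.2 < ω.1 w'.1 → ∀ s ≤ t, ω.2 w s = ω.2 w' s →
      (acq w ↔ acq w') := by
    intro w w' hw hw' s hs h
    have hmet : MetBy ω t ⟨w, hw⟩ ⟨w', hw'⟩ := ⟨s, hs, h⟩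
    exact ⟨fun ⟨_, h1⟩ => ⟨hw', h1.tail hmet⟩, fun ⟨_, h1⟩ => ⟨hw, h1.tail hmet.symm⟩⟩
  -- Walkers from one vertex meet at time 0, so the first walker decides for its vertex.
  have hsame : ∀ v i j, i < ω.1 v → j < ω.1 v → (acq (v, i) ↔ acq (v, j)) := fun v i j hi hj =>
    hstep _ _ hi hj 0 (Nat.zero_le t) (by rw [h0, h0])
  have ha : acq a.1 := ⟨a.2, .single ⟨0, Nat.zero_le t, rfl⟩⟩
  have hb : ¬ acq b.1 := fun ⟨_, h⟩ => hab h
  let U₁ : Finset V := univ.filter fun v => 0 < ω.1 v ∧ acq (v, 0)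
  let U₂ : Finset V := univ.filter fun v => 0 < ω.1 v ∧ ¬ acq (v, 0)
  have h₁ : ∀ v i, i < ω.1 v → (v ∈ U₁ ↔ acq (v, i)) := by
    intro v i hi
    have hpos : 0 < ω.1 v := by omega
    simp [U₁, hpos, hsame v i 0 hi hpos]
  have h₂ : ∀ v i, i < ω.1 v → (v ∈ U₂ ↔ ¬ acq (v, i)) := by
    intro v i hi
    have hpos : 0 < ω.1 v := by omega
    simp [U₂, hpos, hsame v i 0 hi hpos]
  have hU₁ : U₁.Nonempty := ⟨a.1.1, (h₁ _ _ a.2).2 ha⟩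
  have hU₂ : U₂.Nonempty := ⟨b.1.1, (h₂ _ _ b.2).2 hb⟩
  have hpos₁ : ∀ v ∈ U₁, 0 < ω.1 v := fun v hv => (mem_filter.1 hv).2.1
  have hpos₂ : ∀ v ∈ U₂, 0 < ω.1 v := fun v hv => (mem_filter.1 hv).2.1
  rcases le_or_gt #U₁ m with hm₁ | hm₁
  · refine Or.inl ⟨U₁, hU₁, hm₁, fun v hv i hi s hs u hu h => hv ?_⟩
    rw [h₁ v i hi, hstep _ (u, 0) hi (hpos₁ u hu) s hs h, ← h₁ u 0 (hpos₁ u hu)]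
    exact hu
  rcases le_or_gt #U₂ m with hm₂ | hm₂
  · refine Or.inl ⟨U₂, hU₂, hm₂, fun v hv i hi s hs u hu h => hv ?_⟩
    rw [h₂ v i hi, hstep _ (u, 0) hi (hpos₂ u hu) s hs h, ← h₂ u 0 (hpos₂ u hu)]
    exact hu
  · obtain ⟨U, hUs, hU⟩ := exists_subset_card_eq hm₁.le
    obtain ⟨U', hUs', hU'⟩ := exists_subset_card_eq hm₂.le
    refine Or.inr ⟨U, U', ?_, hU, hU', fun s hs u hu u' hu' h => ?_⟩
    · refine disjoint_of_subset_left hUs (disjoint_of_subset_right hUs' ?_)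
      exact disjoint_filter.2 fun v _ h1 h2 => h2.2 h1.2
    · have hu1 := hUs hu
      have hu2 := hUs' hu'
      have hacq := hstep _ _ (hpos₂ u' hu2) (hpos₁ u hu1) s hs h
      exact (h₂ u' 0 (hpos₂ u' hu2)).1 hu2 (hacq.2 ((h₁ u 0 (hpos₁ u hu1)).1 hu1))

theorem socialConnectivityTime_le {V : Type*} {ω : Config V} {t : ℕ} {r : ℝ} (htr : (t : ℝ) ≤ r)
    (h : ∀ a b : Walker ω, AcquaintedBy ω t a b) :
    (socialConnectivityTime ω : ℝ≥0∞) ≤ ENNReal.ofReal r := by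
  have h1 : socialConnectivityTime ω ≤ (t : ℕ∞) := iInf₂_le t h
  calc (socialConnectivityTime ω : ℝ≥0∞) ≤ ((t : ℕ∞) : ℝ≥0∞) := by exact_mod_cast h1
    _ = ENNReal.ofReal t := by simp
    _ ≤ ENNReal.ofReal r := ENNReal.ofReal_le_ofReal htr

variable [MeasurableSpace V] [DiscreteMeasurableSpace V] (G : SimpleGraph V) [DecidableRel G.Adj]

theorem ae_snLaw_start : ∀ᵐ ω ∂(snLaw G), ∀ w, ω.2 w 0 = w.1 := by
  rw [ae_all_iff]
  intro w
  have h1 : ∀ᵐ X ∂(walkersLaw G), X w 0 = w.1 :=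
    (measurePreserving_eval_infinitePi (fun w : V × ℕ => lsrwLaw G w.1) w).quasiMeasurePreserving.ae
      (ae_lsrwLaw_start G w.1)
  exact Measure.quasiMeasurePreserving_snd.ae h1

variable {d J L : ℕ}

theorem Mixes.snLaw_real_not_acquainted_le (hM : Mixes G J L) (hd : G.IsRegularOfDegree d)
    (hd0 : d ≠ 0) (hn : 30000 ≤ Fintype.card V) (hL : 512 * Real.log (Fintype.card V) ≤ L)
    (hL' : (L : ℝ) ≤ 512 * Real.log (Fintype.card V) + 1) {N B : ℕ} (hN : N = 57600000000)
    (hB : B = 480000) :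
    (snLaw G).real {ω | ¬ ∀ a b : Walker ω,
        AcquaintedBy ω (J * (L * (N * B + 11))) a b}
      ≤ (57600009217 : ℝ) / Fintype.card V := by
  classical
  set n := Fintype.card V with hndef
  -- Long enough for both events: `11 = 10 + 1` periods for isolated sets, `N * B` for pairs of
  -- large sets.
  set t := J * (L * (N * B + 11)) with ht
  set m := n / 30000 with hm
  have hL0 : 0 < L := by
    have : 0 < Real.log n := Real.log_pos (by exact_mod_cast (by omega : 1 < n))
    have : (0 : ℝ) < L := by linarith
    exact_mod_cast this
  let F : Finset (Finset V) := univ.filter fun U => #U ∈ Icc 1 m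
  let F' : Finset (Finset V × Finset V) :=
    (powersetCard m univ ×ˢ powersetCard m univ).filter fun p => Disjoint p.1 p.2
  let iso : Finset V → Set (Config V) := fun U => {ω | ∀ v ∉ U, ∀ i < ω.1 v, ∀ s < L * (10 + 1),
    ∀ u ∈ U, ω.2 (v, i) (J * s) ≠ ω.2 (u, 0) (J * s)}
  let nomeet : Finset V × Finset V → Set (V × ℕ → ℕ → V) := fun p =>
    {ω | ∀ s < L * (N * B) + 1, ∀ u ∈ p.1, ∀ u' ∈ p.2,
      ω (u', 0) (J * s) ≠ ω (u, 0) (J * s)}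
  have hsub : {ω | ¬ ∀ a b : Walker ω, AcquaintedBy ω t a b}
      ⊆ ((⋃ U ∈ F, iso U) ∪ ⋃ p ∈ F', {ω : Config V | ω.2 ∈ nomeet p})
        ∪ {ω | ¬ ∀ w, ω.2 w 0 = w.1} := by
    intro ω hω
    by_cases h0 : ∀ w, ω.2 w 0 = w.1
    · left
      have hω' : ¬ ∀ a b : Walker ω, AcquaintedBy ω t a b := hω
      push Not at hω'
      obtain ⟨a, b, hab⟩ := hω'
      rcases exists_isolated_or_no_meeting h0 hab m with
        ⟨U, hU0, hUm, hU⟩ | ⟨U, U', hUU, hUm, hUm', hU⟩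
      · left
        refine Set.mem_biUnion (x := U) (mem_filter.2 ⟨mem_univ U, mem_Icc.2 ⟨hU0.card_pos, hUm⟩⟩) ?_
        intro v hv i hi s hs u hu
        refine hU v hv i hi (J * s) (Nat.mul_le_mul_left J (hs.le.trans ?_)) u hu
        exact Nat.mul_le_mul_left L (by omega)
      · right
        refine Set.mem_biUnion (x := (U, U')) (mem_filter.2 ⟨mem_product.2
          ⟨mem_powersetCard_univ.2 hUm, mem_powersetCard_univ.2 hUm'⟩, hUU⟩) ?_
        intro s hs u hu u' hu'
        refine hU (J * s) (Nat.mul_le_mul_left J ((Nat.lt_succ_iff.1 hs).trans ?_)) u hu u' hu'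
        exact Nat.mul_le_mul_left L (by omega)
    · exact Or.inr h0
  have hnull : (snLaw G).real {ω | ¬ ∀ w, ω.2 w 0 = w.1} = 0 := by
    rw [measureReal_def, show (snLaw G) {ω | ¬ ∀ w, ω.2 w 0 = w.1} = 0 from ae_snLaw_start G]
    rfl
  have hiso : ∑ U ∈ F, (snLaw G).real (iso U)
      ≤ 2 * (L + 1) / (n : ℝ) ^ 2 + n * Real.exp (-((n : ℝ) / 64)) := by
    refine le_trans ?_ (sum_choose_mul_le hL)
    rw [← sum_fiberwise_of_maps_to (s := F) (t := Icc 1 m) (g := fun U => #U)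
      fun U hU => (mem_filter.1 hU).2]
    refine sum_le_sum fun j hj => ?_
    rw [mem_Icc] at hj
    refine (sum_le_card_nsmul _ _ (L * ((n.choose (j / 2) : ℝ) * (2 * (j / 2 : ℕ) / n) ^ j) ^ 10
        + Real.exp (-min ((n : ℝ) / 32) (L * j / 128))) fun U hU => ?_).trans ?_
    · have hUj : #U = j := (mem_filter.1 hU).2
      subst hUj
      exact hM.snLaw_real_isolated_le G hd hd0 (card_pos.1 (by omega)) (by omega) hL0 10
    · rw [nsmul_eq_mul]
      refine mul_le_mul_of_nonneg_right ?_ (by positivity)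
      have : #{U ∈ F | #U = j} ≤ #(powersetCard j (univ : Finset V)) :=
        card_le_card fun U hU => mem_powersetCard_univ.2 (mem_filter.1 hU).2
      rw [card_powersetCard, card_univ] at this
      exact_mod_cast this
  -- There are at most `4 ^ n ≤ exp (2n)` pairs. The constant is `N + 1`: `N` blocks with few sites,
  -- plus avoidance.
  have hnomeet : ∑ p ∈ F', (snLaw G).real {ω : Config V | ω.2 ∈ nomeet p}
      ≤ Real.exp (2 * n) * ((57600000000 + 1) * Real.exp (-(4 * n))) := by
    refine (sum_le_card_nsmul _ _ ((57600000000 + 1) * Real.exp (-(4 * n))) fun p hp => ?_).trans ?_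
    · obtain ⟨hp1, hp2⟩ := mem_filter.1 hp
      obtain ⟨hp1, hp1'⟩ := mem_product.1 hp1
      rw [mem_powersetCard_univ] at hp1 hp1'
      rw [snLaw_real_snd]
      refine (hM.walkersLaw_real_no_meeting_le G hp2 N (B := B) (by omega)).trans ?_
      rw [hp1, hp1', ← hndef]
      have e1 := few_sites_le_exp (n := n) (m := m) (by omega) (by omega) (by omega) hB.ge
      have e2 := avoid_le_exp (n := n) (m := m) (by omega) (by omega) (by omega) hN.ge
      have hN' : (N : ℝ) = 57600000000 := by exact_mod_cast hN
      rw [add_mul, one_mul, ← hN']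
      exact add_le_add (mul_le_mul_of_nonneg_left e1 (Nat.cast_nonneg N)) e2
    · rw [nsmul_eq_mul]
      refine mul_le_mul_of_nonneg_right ?_ (by positivity)
      have h1 : #F' ≤ 2 ^ n * 2 ^ n := by
        refine (card_filter_le _ _).trans ?_
        rw [card_product, card_powersetCard, card_univ]
        exact Nat.mul_le_mul (Nat.choose_le_two_pow _ _) (Nat.choose_le_two_pow _ _)
      have h2 : (2 : ℝ) ^ n ≤ Real.exp n := by
        rw [← Real.exp_one_pow]
        have : (2 : ℝ) ≤ Real.exp 1 := by linarith [Real.add_one_le_exp 1]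
        gcongr
      calc (#F' : ℝ) ≤ 2 ^ n * 2 ^ n := by exact_mod_cast h1
        _ ≤ Real.exp n * Real.exp n := by gcongr
        _ = _ := by rw [← Real.exp_add]; congr 1; ring
  have herr := total_error_le (n := n) (by omega) hL'
  calc _ ≤ _ := measureReal_mono hsub (measure_ne_top _ _)
    _ ≤ _ := measureReal_union_le _ _
    _ ≤ (snLaw G).real (⋃ U ∈ F, iso U)
        + (snLaw G).real (⋃ p ∈ F', {ω : Config V | ω.2 ∈ nomeet p}) := by
      rw [hnull, add_zero]
      exact measureReal_union_le _ _
    _ ≤ ∑ U ∈ F, (snLaw G).real (iso U)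
        + ∑ p ∈ F', (snLaw G).real {ω : Config V | ω.2 ∈ nomeet p} :=
      add_le_add (measureReal_biUnion_finset_le _ _) (measureReal_biUnion_finset_le _ _)
    _ ≤ _ := by linarith

theorem one_sub_div_le_snLaw_real {lam : ℝ} (hG : G.Connected) (hd : G.IsRegularOfDegree d)
    (hlam : 0 < lam) (h : IsExpander G lam) (hn : 30000 ≤ Fintype.card V) :
    1 - 57600009217 / (Fintype.card V : ℝ) ≤ (snLaw G).real
      {ω | (socialConnectivityTime ω : ℝ≥0∞) ≤ ENNReal.ofReal
        (1028 * (57600000000 * 480000 + 11) * lam⁻¹ * Real.log (Fintype.card V))} := by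
  have hnt : Nontrivial V := Fintype.one_lt_card_iff_nontrivial.1 (by omega)
  have hd0 : d ≠ 0 := by
    obtain ⟨v⟩ := hG.nonempty
    have := hG.preconnected.degree_pos_of_nontrivial v
    rw [hd.degree_eq] at this
    omega
  set n := Fintype.card V with hndef
  have hn' : (30000 : ℝ) ≤ n := by exact_mod_cast hn
  -- Absorbs the rounding in `L`, giving `L ≤ 514 log n`; with `J ≤ 2 / lam`, from `lam ≤ 1`, this
  -- yields `1028 = 2 * 514`.
  have hlog : 1 / 2 ≤ Real.log n := by
    have h1 := Real.log_two_gt_d9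
    have h2 : Real.log 2 ≤ Real.log n := Real.log_le_log (by norm_num) (by linarith)
    linarith
  have hlam1 := h.le_one G hd hd0
  set J := ⌈lam⁻¹⌉₊ with hJ
  set L := ⌈512 * Real.log n⌉₊ with hL
  have hJ1 : 1 ≤ lam * J := by
    calc 1 = lam * lam⁻¹ := (mul_inv_cancel₀ hlam.ne').symm
      _ ≤ lam * J := by
        have := Nat.le_ceil lam⁻¹
        gcongr
  have hJ2 : (J : ℝ) ≤ 2 * lam⁻¹ := by
    have h1 := (Nat.ceil_lt_add_one (inv_pos.2 hlam).le).le
    have h2 : 1 ≤ lam⁻¹ := (one_le_inv₀ hlam).2 hlam1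
    linarith
  have hL1 : 512 * Real.log n ≤ L := Nat.le_ceil _
  have hL2 : (L : ℝ) ≤ 512 * Real.log n + 1 := (Nat.ceil_lt_add_one (by linarith)).le
  have hlog2 : Real.log (2 * n) ≤ L := by
    rw [Real.log_mul (by norm_num) (by linarith)]
    have : Real.log 2 ≤ Real.log n := Real.log_le_log (by norm_num) (by linarith)
    linarith
  have hM := h.mixes G hd hd0 hG hlam hJ1 hlog2
  have hbad := hM.snLaw_real_not_acquainted_le G hd hd0 hn hL1 hL2 rfl rfl
  set t := J * (L * (57600000000 * 480000 + 11)) with ht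
  have htr : (t : ℝ) ≤ 1028 * (57600000000 * 480000 + 11) * lam⁻¹ * Real.log n := by
    have hL3 : (L : ℝ) ≤ 514 * Real.log n := by linarith
    have hi : 0 ≤ lam⁻¹ := (inv_pos.2 hlam).le
    calc (t : ℝ) = J * (L * (57600000000 * 480000 + 11)) := by rw [ht]; push_cast; ring
      _ ≤ (2 * lam⁻¹) * ((514 * Real.log n) * (57600000000 * 480000 + 11)) := by gcongr
      _ = _ := by ring
  have hcover : (Set.univ : Set (Config V)) ⊆
      {ω | (socialConnectivityTime ω : ℝ≥0∞) ≤ ENNReal.ofReal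
        (1028 * (57600000000 * 480000 + 11) * lam⁻¹ * Real.log n)}
      ∪ {ω | ¬ ∀ a b : Walker ω, AcquaintedBy ω t a b} := by
    intro ω _
    by_cases hω : ∀ a b : Walker ω, AcquaintedBy ω t a b
    · exact Or.inl (socialConnectivityTime_le htr hω)
    · exact Or.inr hω
  have h1 := (measureReal_mono (μ := snLaw G) hcover (measure_ne_top _ _)).trans
    (measureReal_union_le _ _)
  rw [probReal_univ] at h1
  linarith

end Acquaintance

end SocialNetwork

theorem theorem4 :
    ∃ C C' C₀ : ℝ, 0 < C ∧ 0 < C' ∧ 0 < C₀ ∧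
      ∀ (V : Type*) [Fintype V] [DecidableEq V] [MeasurableSpace V] [DiscreteMeasurableSpace V]
        (G : SimpleGraph V) [DecidableRel G.Adj] (n d : ℕ) (lam : ℝ),
        Fintype.card V = n → G.Connected → G.IsRegularOfDegree d →
        0 < lam → SocialNetwork.IsExpander G lam →
        C₀ * Real.log d ≤ lam * Real.log n →
        1 - C' / n ≤ (SocialNetwork.snLaw G).real
          {ω | (SocialNetwork.socialConnectivityTime ω : ℝ≥0∞) ≤
            ENNReal.ofReal (C * lam⁻¹ * Real.log n)} := by
  refine ⟨1028 * (57600000000 * 480000 + 11), 57600009217, 1, by norm_num, by norm_num,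
    by norm_num, ?_⟩
  intro V _ _ _ _ G _ n d lam hn hG hd hlam hexp _
  subst hn
  rcases le_or_gt 30000 (Fintype.card V) with hn | hn
  · exact SocialNetwork.one_sub_div_le_snLaw_real G hG hd hlam hexp hn
  -- For small `n` the constant `C'` exceeds `n`, so the lower bound is nonpositive.
  · refine le_trans ?_ measureReal_nonneg
    have hne : Nonempty V := hG.nonempty
    have h0 : (0 : ℝ) < Fintype.card V := by exact_mod_cast Fintype.card_pos
    have h1 : (Fintype.card V : ℝ) < 30000 := by exact_mod_cast hn
    rw [sub_nonpos, one_le_div h0]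
    linarith
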